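/- Let $W:\mathbb R\to\mathbb R$ be a $C^\infty$ function supported on $[1,2]$, let $\varepsilon>0$, $K>0$, and let $C(\varepsilon')$, $\varepsilon'>0$, be given constants. Let $Q\ge 1$, let $1\le X\le K Q^{2-4\varepsilon}$, and let $(a_m)$, $(b_n)$ be sequences of complex numbers such that the following bounds hold for every $\varepsilon'>0$, uniformly for all positive integers $c,\ell\le X$ and all Dirichlet characters $\psi$ (primitive or not) of modulus at most $2Q$: $$\Big|\sum_{m\le u,\ (m,c)=1} a_{m\ell}\,\psi(m)\Big|\le C(\varepsilon')\,Q^{\varepsilon'}u^{1/2}\quad\text{for all real } 0<u\le X/\ell,$$ and, for all real $v\ge X/\ell$, the series $\sum_{n>v,\ (n,c)=1} b_{n\ell}\,\psi(n)$ converges (with its terms in their natural order) and $$\Big|\sum_{n> v,\ (n,c)=1} b_{n\ell}\,\psi(n)\Big|\le C(\varepsilon')\,\ell^{-1}Q^{\varepsilon'}v^{-1/2}.$$ Put $A(\chi)=\sum_{m\le X}a_m\chi(m)$ and $B(\chi)=\sum_{n>X}b_n\chi(n)$, and let $$S=\sum_{q\ge1}\frac{W(q/Q)}{\varphi(q)}\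 \sideset{}{^*}\sum_{\chi \bmod q}A(\chi)B(\overline\chi),$$ where $\sideset{}{^*}\sum$ runs over the primitive Dirichlet characters modulo $q$. Then $$|S|\le D\,Q^{1-\varepsilon},$$ where $D$ depends only on $W$, $\varepsilon$, $K$ and the constants $C(\cdot)$, and not on $Q$, $X$, $(a_m)$ or $(b_n)$. -/

import Mathlib

open scoped ContDiff

noncomputable section

/-- `∑_{m ≤ u, (m, c) = 1} a_{mℓ} ψ(m)`, over positive integers `m`. -/
def coprimePartialSum (a : ℕ → ℂ) (c l : ℕ) {q : ℕ} (ψ : DirichletCharacter ℂ q) (u : ℝ) : ℂ :=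
  ∑ m ∈ (Finset.Icc 1 ⌊u⌋₊).filter (fun m => Nat.Coprime m c), a (m * l) * ψ (m : ZMod q)

/-- The terms of the series `∑_{n > v, (n, c) = 1} b_{nℓ} ψ(n)`. -/
def coprimeTailTerm (b : ℕ → ℂ) (c l : ℕ) {q : ℕ} (ψ : DirichletCharacter ℂ q) (v : ℝ) (n : ℕ) :
    ℂ :=
  if v < (n : ℝ) ∧ Nat.Coprime n c then b (n * l) * ψ (n : ZMod q) else 0

/-- For every `ε > 0`, `|∑_{m ≤ u, (m, c) = 1} a_{mℓ} ψ(m)| ≤ C(ε) Q^ε u^{1/2}`, uniformly for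
`c, ℓ ≤ X`, for all Dirichlet characters `ψ` (primitive or not) of modulus at most `2Q`, and for
`0 < u ≤ X / ℓ` (so that only the `a_n` with `n ≤ X` are involved). -/
def PartialSumBound (Q X : ℝ) (C : ℝ → ℝ) (a : ℕ → ℂ) : Prop :=
  ∀ ε : ℝ, 0 < ε →
    ∀ c l q : ℕ, 1 ≤ c → (c : ℝ) ≤ X → 1 ≤ l → (l : ℝ) ≤ X → 1 ≤ q → (q : ℝ) ≤ 2 * Q →
      ∀ (ψ : DirichletCharacter ℂ q) (u : ℝ), 0 < u → u ≤ X / (l : ℝ) →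
        ‖coprimePartialSum a c l ψ u‖ ≤ C ε * Q ^ ε * u ^ (1 / 2 : ℝ)

/-- For every `ε > 0`, the series `∑_{n > v, (n, c) = 1} b_{nℓ} ψ(n)` converges (as the limit of
its partial sums in the natural order) and its sum is at most `C(ε) ℓ⁻¹ Q^ε v^{-1/2}` in absolute
value, uniformly for `c, ℓ ≤ X`, for all Dirichlet characters `ψ` (primitive or not) of modulus at
most `2Q`, and for `v ≥ X / ℓ` (so that only the `b_n` with `n > X` are involved). -/
def TailSumBound (Q X : ℝ) (C : ℝ → ℝ) (b : ℕ → ℂ) : Prop :=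
  ∀ ε : ℝ, 0 < ε →
    ∀ c l q : ℕ, 1 ≤ c → (c : ℝ) ≤ X → 1 ≤ l → (l : ℝ) ≤ X → 1 ≤ q → (q : ℝ) ≤ 2 * Q →
      ∀ (ψ : DirichletCharacter ℂ q) (v : ℝ), X / (l : ℝ) ≤ v →
        ∃ s : ℂ, HasSum (coprimeTailTerm b c l ψ v) s (SummationFilter.conditional ℕ) ∧
          ‖s‖ ≤ C ε * (l : ℝ)⁻¹ * Q ^ ε * v ^ (-(1 / 2) : ℝ)

/-- `A(χ) = ∑_{m ≤ X} a_m χ(m)`. -/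
def charA (X : ℝ) (a : ℕ → ℂ) {q : ℕ} (χ : DirichletCharacter ℂ q) : ℂ :=
  ∑ m ∈ Finset.Icc 1 ⌊X⌋₊, a m * χ (m : ZMod q)

/-- `B(χ) = ∑_{n > X} b_n χ(n)`, summed in the natural order. -/
def charB (X : ℝ) (b : ℕ → ℂ) {q : ℕ} (χ : DirichletCharacter ℂ q) : ℂ :=
  ∑'[SummationFilter.conditional ℕ] n : ℕ, if X < (n : ℝ) then b n * χ (n : ZMod q) else 0

/-- `S = ∑_q W(q/Q)/φ(q) ∑*_{χ mod q} A(χ) B(χ̄)`, the inner sum over primitive characters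
modulo `q`; here `χ⁻¹ = χ̄`. -/
def sieveSum (W : ℝ → ℝ) (Q X : ℝ) (a b : ℕ → ℂ) : ℂ :=
  ∑ᶠ (q : ℕ) (_ : 1 ≤ q), ((W ((q : ℝ) / Q) / (Nat.totient q : ℝ) : ℝ) : ℂ) *
    ∑ᶠ (χ : DirichletCharacter ℂ q) (_ : χ.IsPrimitive), charA X a χ * charB X b χ⁻¹

end

/-! Write q = de. Möbius inversion replaces the primitive characters modulo q by all characters
modulo q of conductor dividing e, with weight μ(d) (`sieveSum_eq`). Once B is cut off at some v ≥ X,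
orthogonality turns them into φ(e)/φ(de) times the sum of a_m b_n over m ≡ n mod e with m, n coprime
to de (`norm_sum_charA_mul_charB_sub_le`).

Since m ≤ X < n, the modulus e divides the nonzero integer n - m, so it can be traded for the
complementary divisor f, of size at most dv/Q. Two things tie the summand to e beforehand: the
factor φ(e)/φ(de), and coprimality to e. Both are opened by Möbius sums, over k ∣ d and over common
divisors l of m, n, e. After the switch the common factor g of m and f is taken out, f = gf', and
the congruence modulo kf' is detected by characters modulo df' (`sumAcross_modulus_eq`,
`norm_sumAcross_modEq_le`). These moduli are at most 2Q, so the hypotheses on a and b apply again,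
with ℓ = lg. The smooth weight in n - m is removed by double summation by parts at a cost
independent of its scale (`norm_sum_sum_mul_weight_le`), and the powers of X in the bounds for a and
b cancel.

For each d, truncation costs about (Q/d)(X/v)^{1/2} and the dual sum about dv/Q, the number of f.
With T = (QX)^{1/3} and v = X(Q/(dT))² (or v = X if this is smaller) both are at most about T, up to
logarithms and Q^{ε'} (`norm_sieveSum_le`). The hypothesis on X makes T ≪ Q^{1-4ε/3}, which leaves
room for those losses. -/

/-! ### Characters induced from a divisor: orthogonality and Möbius inversion. -/

/-- The Dirichlet characters modulo `q` whose conductor divides `e`. -/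
noncomputable def charsOfConductorDvd (q e : ℕ) : Finset (DirichletCharacter ℂ q) :=
  letI := Classical.decPred fun χ : DirichletCharacter ℂ q => χ.conductor ∣ e
  Finset.univ.filter fun χ => χ.conductor ∣ e

lemma mem_charsOfConductorDvd {q e : ℕ} {χ : DirichletCharacter ℂ q} :
    χ ∈ charsOfConductorDvd q e ↔ χ.conductor ∣ e := by
  simp [charsOfConductorDvd]

/-- A character has conductor dividing e exactly when it factors through e, and `changeLevel` is
injective, so lifting is a bijection. -/
lemma sum_charsOfConductorDvd {q e : ℕ} [NeZero q] (h : e ∣ q)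
    (F : DirichletCharacter ℂ q → ℂ) :
    ∑ χ ∈ charsOfConductorDvd q e, F χ =
      ∑ ψ : DirichletCharacter ℂ e, F (DirichletCharacter.changeLevel h ψ) := by
  symm
  refine Finset.sum_bij (fun ψ _ => DirichletCharacter.changeLevel h ψ) ?_ ?_ ?_ ?_
  · intro ψ _
    rw [mem_charsOfConductorDvd, ← DirichletCharacter.mem_conductorSet_iff_conductor_dvd _ h]
    exact DirichletCharacter.changeLevel_factorsThrough ψ h
  · intro ψ _ ψ' _ hh
    exact DirichletCharacter.changeLevel_injective h hh
  · intro χ hχ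
    rw [mem_charsOfConductorDvd, ← DirichletCharacter.mem_conductorSet_iff_conductor_dvd _ h] at hχ
    obtain ⟨_, ψ, hψ⟩ := hχ
    exact ⟨ψ, Finset.mem_univ _, hψ.symm⟩
  · intro ψ _
    rfl

lemma changeLevel_natCast {q e : ℕ} (h : e ∣ q) (ψ : DirichletCharacter ℂ e) {m : ℕ}
    (hm : m.Coprime q) :
    DirichletCharacter.changeLevel h ψ (m : ZMod q) = ψ (m : ZMod e) := by
  have := DirichletCharacter.changeLevel_eq_cast_of_dvd' ψ h (a := (m : ℤ))
    (Nat.isCoprime_iff_coprime.mpr hm)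
  simpa using this

lemma DirichletCharacter.natCast_eq_zero {q : ℕ} (χ : DirichletCharacter ℂ q) {m : ℕ}
    (hm : ¬ m.Coprime q) : χ (m : ZMod q) = 0 :=
  χ.map_nonunit fun h => hm ((ZMod.isUnit_iff_coprime m q).mp h)

lemma card_charsOfConductorDvd {q e : ℕ} [NeZero q] (h : e ∣ q) :
    (charsOfConductorDvd q e).card = Nat.totient e := by
  have : NeZero e := ⟨fun h0 => NeZero.ne q (Nat.eq_zero_of_zero_dvd (h0 ▸ h))⟩
  have h1 := sum_charsOfConductorDvd h (fun _ => 1)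
  simp only [Finset.sum_const, nsmul_eq_mul, mul_one] at h1
  have h2 := DirichletCharacter.card_eq_totient_of_hasEnoughRootsOfUnity ℂ e
  rw [Nat.card_eq_fintype_card] at h2
  rw [Finset.card_univ, h2] at h1
  exact_mod_cast h1

/-- Orthogonality for the characters modulo `q` induced from the divisor `e`. -/
lemma sum_charsOfConductorDvd_mul {q e : ℕ} [NeZero q] (h : e ∣ q) (m n : ℕ) :
    ∑ χ ∈ charsOfConductorDvd q e, χ (m : ZMod q) * χ⁻¹ (n : ZMod q) =
      if (m.Coprime q ∧ n.Coprime q) ∧ m ≡ n [MOD e] then (Nat.totient e : ℂ) else 0 := by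
  have : NeZero e := ⟨fun h0 => NeZero.ne q (Nat.eq_zero_of_zero_dvd (h0 ▸ h))⟩
  by_cases hc : m.Coprime q ∧ n.Coprime q
  · obtain ⟨hm, hn⟩ := hc
    rw [sum_charsOfConductorDvd h]
    have hne : n.Coprime e := Nat.Coprime.coprime_dvd_right h hn
    have hunit : IsUnit (n : ZMod e) := (ZMod.isUnit_iff_coprime n e).mpr hne
    have key := DirichletCharacter.sum_char_inv_mul_char_eq ℂ hunit (m : ZMod e)
    have : ∀ ψ : DirichletCharacter ℂ e,
        DirichletCharacter.changeLevel h ψ (m : ZMod q) *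
          (DirichletCharacter.changeLevel h ψ)⁻¹ (n : ZMod q) =
        ψ (n : ZMod e)⁻¹ * ψ (m : ZMod e) := by
      intro ψ
      rw [← map_inv, changeLevel_natCast h _ hm, changeLevel_natCast h _ hn, mul_comm]
      congr 1
      apply mul_right_cancel₀ (b := ψ (n : ZMod e)) (hunit.map ψ).ne_zero
      rw [← map_mul, ZMod.inv_mul_of_unit _ hunit, map_one, ← MulChar.mul_apply, inv_mul_cancel,
        MulChar.one_apply hunit]
    rw [Finset.sum_congr rfl fun ψ _ => this ψ, key]
    refine if_congr ?_ rfl rfl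
    rw [eq_comm, ZMod.natCast_eq_natCast_iff]
    exact ⟨fun h => ⟨⟨hm, hn⟩, h⟩, fun h => h.2⟩
  · rw [if_neg fun hh => hc hh.1]
    refine Finset.sum_eq_zero fun χ _ => ?_
    rw [not_and_or] at hc
    rcases hc with hc | hc
    · rw [DirichletCharacter.natCast_eq_zero _ hc, zero_mul]
    · rw [DirichletCharacter.natCast_eq_zero χ⁻¹ hc, mul_zero]

open ArithmeticFunction in
lemma sum_divisors_moebius (n : ℕ) :
    ∑ d ∈ n.divisors, (moebius d : ℂ) = if n = 1 then 1 else 0 := by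
  have h := congrArg (fun f : ArithmeticFunction ℤ => f n) moebius_mul_coe_zeta
  simp only [coe_mul_zeta_apply, one_apply] at h
  have := congrArg (fun z : ℤ => (z : ℂ)) h
  push_cast at this
  simpa using this

-- With c the conductor of χ, this says that Möbius inversion keeps χ only if it is primitive. The
-- cofactors x.1 that occur are the divisors of q/c.
open ArithmeticFunction in
lemma sum_divisorsAntidiagonal_moebius_of_dvd {q c : ℕ} (hq : q ≠ 0) (hc : c ∣ q) :
    ∑ x ∈ q.divisorsAntidiagonal, (if c ∣ x.2 then (moebius x.1 : ℂ) else 0) =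
      if c = q then 1 else 0 := by
  obtain ⟨t, rfl⟩ := hc
  have hc0 : c ≠ 0 := left_ne_zero_of_mul hq
  have ht0 : t ≠ 0 := right_ne_zero_of_mul hq
  have h3 : ∑ x ∈ (c * t).divisorsAntidiagonal, (if c ∣ x.2 then (moebius x.1 : ℂ) else 0) =
      ∑ d ∈ t.divisors, (moebius d : ℂ) := by
    rw [Nat.sum_divisorsAntidiagonal (fun a b => if c ∣ b then (moebius a : ℂ) else 0),
      ← Finset.sum_filter]
    refine Finset.sum_congr ?_ fun _ _ => rfl
    ext d
    simp only [Finset.mem_filter, Nat.mem_divisors]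
    constructor
    · rintro ⟨⟨⟨s, hs⟩, _⟩, h⟩
      have hd0 : d ≠ 0 := by rintro rfl; simp at hs; omega
      rw [hs, Nat.mul_div_cancel_left _ (Nat.pos_of_ne_zero hd0)] at h
      obtain ⟨r, hr⟩ := h
      refine ⟨⟨r, ?_⟩, ht0⟩
      apply Nat.eq_of_mul_eq_mul_left (Nat.pos_of_ne_zero hc0)
      rw [hs, hr]; ring
    · rintro ⟨⟨r, rfl⟩, _⟩
      have hd0 : d ≠ 0 := left_ne_zero_of_mul ht0
      have : c * (d * r) = d * (c * r) := by ring
      refine ⟨⟨⟨_, this⟩, hq⟩, ?_⟩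
      rw [this, Nat.mul_div_cancel_left _ (Nat.pos_of_ne_zero hd0)]
      exact Dvd.intro _ rfl
  rw [h3, sum_divisors_moebius]
  refine if_congr ?_ rfl rfl
  constructor
  · rintro rfl; simp
  · intro h
    exact Nat.eq_of_mul_eq_mul_left (Nat.pos_of_ne_zero hc0) (by omega)

open ArithmeticFunction in
/-- Möbius inversion from all characters to primitive characters. -/
lemma sum_primitive_eq {q : ℕ} [NeZero q] (F : DirichletCharacter ℂ q → ℂ) :
    (∑ᶠ (χ : DirichletCharacter ℂ q) (_ : χ.IsPrimitive), F χ) =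
      ∑ x ∈ q.divisorsAntidiagonal, (moebius x.1 : ℂ) *
        ∑ χ ∈ charsOfConductorDvd q x.2, F χ := by
  classical
  have h1 : (∑ᶠ (χ : DirichletCharacter ℂ q) (_ : χ.IsPrimitive), F χ) =
      ∑ χ : DirichletCharacter ℂ q, if χ.conductor = q then F χ else 0 := by
    rw [finsum_eq_sum_of_fintype]
    refine Finset.sum_congr rfl fun χ _ => ?_
    rw [finsum_eq_if]
    exact if_congr Iff.rfl rfl rfl
  rw [h1]
  have h2 : ∀ x ∈ q.divisorsAntidiagonal, (moebius x.1 : ℂ) *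
      ∑ χ ∈ charsOfConductorDvd q x.2, F χ =
      ∑ χ : DirichletCharacter ℂ q, (if χ.conductor ∣ x.2 then (moebius x.1 : ℂ) else 0) * F χ := by
    intro x _
    rw [charsOfConductorDvd, Finset.sum_filter, Finset.mul_sum]
    refine Finset.sum_congr rfl fun χ _ => ?_
    split_ifs <;> simp
  rw [Finset.sum_congr rfl h2, Finset.sum_comm]
  refine Finset.sum_congr rfl fun χ _ => ?_
  rw [← Finset.sum_mul, sum_divisorsAntidiagonal_moebius_of_dvd (NeZero.ne q)
    (DirichletCharacter.conductor_dvd_level χ)]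
  split_ifs <;> simp

/-! ### Summation by parts in one and two variables. -/

/-- Summation by parts: a sum weighted by `g` is bounded by the partial sums times the total
variation of `g`. -/
lemma norm_sum_Ioc_mul_le {M N : ℕ} (hMN : M ≤ N) (β g : ℕ → ℂ) {B : ℝ}
    (hB : ∀ j, M ≤ j → j ≤ N → ‖∑ n ∈ Finset.Ioc M j, β n‖ ≤ B) :
    ‖∑ n ∈ Finset.Ioc M N, β n * g n‖ ≤
      B * (‖g N‖ + ∑ i ∈ Finset.Ioo M N, ‖g (i + 1) - g i‖) := by
  have key : ∀ k, M ≤ k → k ≤ N → ∑ n ∈ Finset.Ioc M k, β n * g n =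
      (∑ n ∈ Finset.Ioc M k, β n) * g k -
        ∑ i ∈ Finset.Ioo M k, (∑ n ∈ Finset.Ioc M i, β n) * (g (i + 1) - g i) := by
    intro k hk
    induction k, hk using Nat.le_induction with
    | base => simp
    | succ k hk ih =>
      intro hkN
      rcases hk.eq_or_lt with rfl | hlt
      · have : Finset.Ioo M (M + 1) = ∅ := by
          ext x; simp only [Finset.mem_Ioo, Finset.notMem_empty, iff_false]; omega
        simp [this]
      · have e1 : Finset.Ioo M (k + 1) = insert k (Finset.Ioo M k) := by
          ext x; simp only [Finset.mem_Ioo, Finset.mem_insert]; omega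
        rw [Finset.sum_Ioc_succ_top hk, Finset.sum_Ioc_succ_top hk, ih (by omega), e1,
          Finset.sum_insert (by simp)]
        ring
  rw [key N hMN le_rfl, mul_add, Finset.mul_sum]
  refine (norm_sub_le _ _).trans (add_le_add ?_ ?_)
  · rw [norm_mul]
    exact mul_le_mul_of_nonneg_right (hB N hMN le_rfl) (norm_nonneg _)
  · refine (norm_sum_le _ _).trans (Finset.sum_le_sum fun i hi => ?_)
    rw [norm_mul]
    rw [Finset.mem_Ioo] at hi
    exact mul_le_mul_of_nonneg_right (hB i hi.1.le hi.2.le) (norm_nonneg _)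

/-- Double summation by parts. -/
lemma norm_sum_sum_mul_le {M N : ℕ} (hMN : M ≤ N) (α β : ℕ → ℂ) (F : ℕ → ℕ → ℂ) {A B : ℝ}
    (hA0 : 0 ≤ A)
    (hA : ∀ j, j ≤ M → ‖∑ m ∈ Finset.Ioc 0 j, α m‖ ≤ A)
    (hB : ∀ j, M ≤ j → j ≤ N → ‖∑ n ∈ Finset.Ioc M j, β n‖ ≤ B) :
    ‖∑ m ∈ Finset.Ioc 0 M, ∑ n ∈ Finset.Ioc M N, α m * β n * F m n‖ ≤
      A * B * (‖F M N‖ + ∑ j ∈ Finset.Ioo M N, ‖F M (j + 1) - F M j‖ +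
        ∑ i ∈ Finset.Ioo 0 M, (‖F (i + 1) N - F i N‖ +
          ∑ j ∈ Finset.Ioo M N, ‖F (i + 1) (j + 1) - F i (j + 1) - (F (i + 1) j - F i j)‖)) := by
  have h1 : ∑ m ∈ Finset.Ioc 0 M, ∑ n ∈ Finset.Ioc M N, α m * β n * F m n =
      ∑ m ∈ Finset.Ioc 0 M, α m * ∑ n ∈ Finset.Ioc M N, β n * F m n := by
    refine Finset.sum_congr rfl fun m _ => ?_
    rw [Finset.mul_sum]
    exact Finset.sum_congr rfl fun n _ => by ring
  rw [h1]
  refine (norm_sum_Ioc_mul_le (Nat.zero_le M) α (fun m => ∑ n ∈ Finset.Ioc M N, β n * F m n)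
    fun j _ hj => hA j hj).trans ?_
  rw [mul_assoc]
  refine mul_le_mul_of_nonneg_left ?_ hA0
  rw [mul_add, Finset.mul_sum]
  refine add_le_add (norm_sum_Ioc_mul_le hMN β (F M) hB) (Finset.sum_le_sum fun i _ => ?_)
  rw [← Finset.sum_sub_distrib]
  simp only [← mul_sub]
  exact norm_sum_Ioc_mul_le hMN β (fun n => F (i + 1) n - F i n) hB

/-! ### Removing a smooth weight in n - m. -/

lemma exists_bound_of_support {f : ℝ → ℝ} (hf : Continuous f) (hs : HasCompactSupport f) :
    ∃ w : ℝ, 0 ≤ w ∧ ∀ x, |f x| ≤ w := by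
  obtain ⟨w, hw⟩ := hf.bounded_above_of_compact_support hs
  exact ⟨w, (norm_nonneg _).trans (hw 0), hw⟩

/-- The mean value inequality; used for W, and for y ↦ W(y + h) - W(y) to reach second differences.
-/
lemma abs_sub_le_of_deriv_le {f : ℝ → ℝ} (hf : Differentiable ℝ f) {w : ℝ}
    (hw : ∀ x, |deriv f x| ≤ w) (x y : ℝ) : |f y - f x| ≤ w * |y - x| :=
  Convex.norm_image_sub_le_of_norm_deriv_le (s := Set.univ) (fun x _ => hf x) (fun x _ => hw x)
    convex_univ (Set.mem_univ x) (Set.mem_univ y)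

/-- A smooth compactly supported function is bounded with bounded first and second differences. -/
lemma exists_difference_bounds {W : ℝ → ℝ} (hW : ContDiff ℝ ∞ W)
    (hWsupp : Function.support W ⊆ Set.Icc 1 2) :
    ∃ w : ℝ, 0 ≤ w ∧ (∀ x, |W x| ≤ w) ∧ (∀ x y, |W y - W x| ≤ w * |y - x|) ∧
      ∀ x h : ℝ, |W (x + h) - W x - (W x - W (x - h))| ≤ w * h ^ 2 := by
  have hcs : HasCompactSupport W :=
    HasCompactSupport.of_support_subset_isCompact isCompact_Icc hWsupp
  have hd1 : ContDiff ℝ ∞ (deriv W) := (contDiff_infty_iff_deriv.mp hW).2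
  have hd2 : ContDiff ℝ ∞ (deriv (deriv W)) := (contDiff_infty_iff_deriv.mp hd1).2
  obtain ⟨w0, h00, h0⟩ := exists_bound_of_support hW.continuous hcs
  obtain ⟨w1, h10, h1⟩ := exists_bound_of_support hd1.continuous hcs.deriv
  obtain ⟨w2, h20, h2⟩ := exists_bound_of_support hd2.continuous hcs.deriv.deriv
  have hWd : Differentiable ℝ W := hW.differentiable (by simp)
  have hW1d : Differentiable ℝ (deriv W) := hd1.differentiable (by simp)
  refine ⟨w0 + w1 + w2, by positivity, fun x => (h0 x).trans (by linarith), fun x y => ?_,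
    fun x h => ?_⟩
  · refine (abs_sub_le_of_deriv_le hWd h1 x y).trans ?_
    exact mul_le_mul_of_nonneg_right (by linarith) (abs_nonneg _)
  · have hG : Differentiable ℝ (fun y => W (y + h) - W y) :=
      (hWd.comp (differentiable_id.add_const h)).sub hWd
    have hGd : ∀ y, |deriv (fun y => W (y + h) - W y) y| ≤ w2 * |h| := by
      intro y
      have : deriv (fun y => W (y + h) - W y) y = deriv W (y + h) - deriv W y := by
        have h3 : DifferentiableAt ℝ (fun y => W (y + h)) y :=
          (hWd.comp (differentiable_id.add_const h)) y
        rw [deriv_fun_sub h3 (hWd y), deriv_comp_add_const]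
      rw [this]
      simpa using abs_sub_le_of_deriv_le hW1d h2 y (y + h)
    have := abs_sub_le_of_deriv_le hG hGd (x - h) x
    simp only [sub_add_cancel, sub_sub_cancel] at this
    refine this.trans ?_
    rw [mul_assoc, ← sq, sq_abs]
    exact mul_le_mul_of_nonneg_right (by linarith) (sq_nonneg _)

/-- If the nonzero terms lie in a range of length `2 / l`, the sum is at most `2 / l` times the
largest term. -/
lemma sum_le_of_support_le {s : Finset ℕ} {l c : ℝ} (hl : 0 < l) (hc : 0 ≤ c)
    (φ : ℕ → ℕ) (hφ : Set.InjOn φ s) (hφ1 : ∀ i ∈ s, 1 ≤ φ i) (f : ℕ → ℝ) (hf : ∀ i ∈ s, f i ≤ c)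
    (hf0 : ∀ i ∈ s, 2 < l * φ i → f i ≤ 0) :
    ∑ i ∈ s, f i ≤ 2 / l * c := by
  classical
  have h1 : ∑ i ∈ s, f i ≤ ∑ i ∈ s.filter (fun i => l * φ i ≤ 2), c := by
    rw [Finset.sum_filter]
    refine Finset.sum_le_sum fun i hi => ?_
    split_ifs with h
    · exact hf i hi
    · exact hf0 i hi (not_le.mp h)
  refine h1.trans ?_
  rw [Finset.sum_const, nsmul_eq_mul]
  refine mul_le_mul_of_nonneg_right ?_ hc
  have h2 : (s.filter (fun i => l * φ i ≤ 2)).card ≤ (Finset.Icc 1 ⌊2 / l⌋₊).card := by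
    refine Finset.card_le_card_of_injOn φ ?_ (hφ.mono fun x hx => (Finset.mem_filter.mp hx).1)
    intro i hi
    simp only [Finset.coe_filter, Set.mem_ofPred_eq] at hi
    simp only [Finset.coe_Icc, Set.mem_Icc]
    refine ⟨hφ1 i hi.1, Nat.le_floor ?_⟩
    rw [le_div_iff₀ hl, mul_comm]
    exact hi.2
  rw [Nat.card_Icc, Nat.add_sub_cancel] at h2
  calc ((s.filter (fun i => l * φ i ≤ 2)).card : ℝ) ≤ (⌊2 / l⌋₊ : ℝ) := by exact_mod_cast h2
    _ ≤ 2 / l := Nat.floor_le (by positivity)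

/-- Bilinear sums weighted by `W (l (n - m))`, with `W` smooth, are controlled by partial sums. -/
lemma norm_sum_sum_mul_weight_le {W : ℝ → ℝ} {w : ℝ} (hw0 : 0 ≤ w) (hW0 : ∀ x, |W x| ≤ w)
    (hW1 : ∀ x y, |W y - W x| ≤ w * |y - x|)
    (hW2 : ∀ x h : ℝ, |W (x + h) - W x - (W x - W (x - h))| ≤ w * h ^ 2)
    (hWsupp : ∀ x, 2 < x → W x = 0) {l : ℝ} (hl : 0 < l)
    {M N : ℕ} (hMN : M ≤ N) (α β : ℕ → ℂ) {A B : ℝ} (hA0 : 0 ≤ A) (hB0 : 0 ≤ B)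
    (hA : ∀ j, j ≤ M → ‖∑ m ∈ Finset.Ioc 0 j, α m‖ ≤ A)
    (hB : ∀ j, M ≤ j → j ≤ N → ‖∑ n ∈ Finset.Ioc M j, β n‖ ≤ B) :
    ‖∑ m ∈ Finset.Ioc 0 M, ∑ n ∈ Finset.Ioc M N,
      α m * β n * (W (l * ((n : ℝ) - m)) : ℂ)‖ ≤ A * B * (9 * w) := by
  rcases hMN.eq_or_lt with rfl | hlt
  · simp; positivity
  refine (norm_sum_sum_mul_le hMN α β (fun m n => (W (l * ((n : ℝ) - m)) : ℂ)) hA0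
    hA hB).trans ?_
  refine mul_le_mul_of_nonneg_left ?_ (mul_nonneg hA0 hB0)
  -- Since m ≤ M < n, the distance of either variable from M is a lower bound for n - m. Beyond
  -- distance 2 / l the weight vanishes, so each variable has at most 2 / l relevant values.
  have hlM : ∀ {x y : ℝ} {k : ℕ}, 2 < l * k → (k : ℝ) ≤ y - x → W (l * (y - x)) = 0 := by
    intro x y k h1 h2
    exact hWsupp _ (h1.trans_le (mul_le_mul_of_nonneg_left h2 hl.le))
  have e1 : ‖(W (l * ((N : ℝ) - M)) : ℂ)‖ ≤ w := by
    rw [Complex.norm_real]; exact hW0 _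
  have e2 : ∑ j ∈ Finset.Ioo M N, ‖(W (l * (((j + 1 : ℕ) : ℝ) - M)) : ℂ) -
      (W (l * ((j : ℝ) - M)) : ℂ)‖ ≤ 2 / l * (w * l) := by
    refine sum_le_of_support_le hl (by positivity) (fun j => j - M) ?_ ?_ _ ?_ ?_
    · intro i hi j hj hij
      simp only [Finset.coe_Ioo, Set.mem_Ioo] at hi hj hij
      omega
    · intro i hi
      rw [Finset.mem_Ioo] at hi
      omega
    · intro i _
      rw [← Complex.ofReal_sub, Complex.norm_real]
      refine (hW1 _ _).trans (le_of_eq ?_)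
      push_cast
      rw [show l * ((i : ℝ) + 1 - M) - l * ((i : ℝ) - M) = l by ring, abs_of_pos hl]
    · intro i hi h
      rw [Finset.mem_Ioo] at hi
      have hc : ((i - M : ℕ) : ℝ) = (i : ℝ) - M := by rw [Nat.cast_sub hi.1.le]
      rw [hlM h (by rw [hc]; push_cast; linarith), hlM h (by rw [hc])]
      simp
  have e3 : ∑ i ∈ Finset.Ioo 0 M, ‖(W (l * ((N : ℝ) - ((i + 1 : ℕ) : ℝ))) : ℂ) -
      (W (l * ((N : ℝ) - i)) : ℂ)‖ ≤ 2 / l * (w * l) := by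
    refine sum_le_of_support_le hl (by positivity) (fun i => M - i) ?_ ?_ _ ?_ ?_
    · intro i hi j hj hij
      simp only [Finset.coe_Ioo, Set.mem_Ioo] at hi hj hij
      omega
    · intro i hi
      rw [Finset.mem_Ioo] at hi
      omega
    · intro i _
      rw [← Complex.ofReal_sub, Complex.norm_real]
      refine (hW1 _ _).trans (le_of_eq ?_)
      push_cast
      rw [show l * ((N : ℝ) - (i + 1)) - l * ((N : ℝ) - i) = -l by ring, abs_neg, abs_of_pos hl]
    · intro i hi h
      rw [Finset.mem_Ioo] at hi
      have hc : ((M - i : ℕ) : ℝ) = (M : ℝ) - i := by rw [Nat.cast_sub hi.2.le]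
      have hN : (M : ℝ) + 1 ≤ N := by exact_mod_cast hlt
      rw [hlM h (by rw [hc]; push_cast; linarith), hlM h (by rw [hc]; linarith)]
      simp
  -- The weight depends only on n - m, so the mixed difference is, up to sign, a second difference
  -- of W with step l. It is O(l²), against (2 / l)² relevant pairs.
  have e4 : ∑ i ∈ Finset.Ioo 0 M, ∑ j ∈ Finset.Ioo M N,
      ‖(W (l * (((j + 1 : ℕ) : ℝ) - ((i + 1 : ℕ) : ℝ))) : ℂ) - (W (l * (((j + 1 : ℕ) : ℝ) - i)) : ℂ)
        - ((W (l * ((j : ℝ) - ((i + 1 : ℕ) : ℝ))) : ℂ) - (W (l * ((j : ℝ) - i)) : ℂ))‖ ≤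
      2 / l * (2 / l * (w * l ^ 2)) := by
    refine sum_le_of_support_le hl (by positivity) (fun i => M - i) ?_ ?_ _ ?_ ?_
    · intro i hi j hj hij
      simp only [Finset.coe_Ioo, Set.mem_Ioo] at hi hj hij
      omega
    · intro i hi
      rw [Finset.mem_Ioo] at hi
      omega
    · intro i hi
      rw [Finset.mem_Ioo] at hi
      have hiM : (i : ℝ) + 1 ≤ M := by exact_mod_cast hi.2
      refine sum_le_of_support_le hl (by positivity) (fun j => j - M) ?_ ?_ _ ?_ ?_
      · intro i hi j hj hij
        simp only [Finset.coe_Ioo, Set.mem_Ioo] at hi hj hij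
        omega
      · intro i hi
        rw [Finset.mem_Ioo] at hi
        omega
      · intro j _
        simp only [← Complex.ofReal_sub]
        rw [Complex.norm_real, Real.norm_eq_abs, ← abs_neg]
        refine (le_of_eq ?_).trans (hW2 (l * ((j : ℝ) - i)) l)
        congr 1
        push_cast
        rw [show l * ((j : ℝ) + 1 - (i + 1)) = l * (j - i) by ring,
          show l * ((j : ℝ) + 1 - i) = l * (j - i) + l by ring,
          show l * ((j : ℝ) - (i + 1)) = l * (j - i) - l by ring]
        ring
      · intro j hj h
        rw [Finset.mem_Ioo] at hj
        have hc : ((j - M : ℕ) : ℝ) = (j : ℝ) - M := by rw [Nat.cast_sub hj.1.le]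
        rw [hlM h (by rw [hc]; push_cast; linarith), hlM h (by rw [hc]; push_cast; linarith),
          hlM h (by rw [hc]; push_cast; linarith), hlM h (by rw [hc]; linarith)]
        simp
    · intro i hi h
      rw [Finset.mem_Ioo] at hi
      refine (Finset.sum_eq_zero fun j hj => ?_).le
      rw [Finset.mem_Ioo] at hj
      have hc : ((M - i : ℕ) : ℝ) = (M : ℝ) - i := by rw [Nat.cast_sub hi.2.le]
      have hN : (M : ℝ) + 1 ≤ j := by exact_mod_cast hj.1
      rw [hlM h (by rw [hc]; push_cast; linarith), hlM h (by rw [hc]; push_cast; linarith),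
        hlM h (by rw [hc]; push_cast; linarith), hlM h (by rw [hc]; linarith)]
      simp
  -- 9 = 1 + 2 + 2 + 4: the corner, the two edges and the interior.
  rw [Finset.sum_add_distrib]
  refine (add_le_add (add_le_add e1 e2) (add_le_add e3 e4)).trans (le_of_eq ?_)
  field_simp
  ring

/-! ### Bilinear sums across a cut, restricted to multiples of l. -/

/-- The sum of `G m n` over `0 < m ≤ M < n ≤ N`. -/
noncomputable def sumAcross (M N : ℕ) (G : ℕ → ℕ → ℂ) : ℂ :=
  ∑ m ∈ Finset.Ioc 0 M, ∑ n ∈ Finset.Ioc M N, G m n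

lemma sumAcross_congr {M N : ℕ} {G H : ℕ → ℕ → ℂ}
    (h : ∀ m n, 0 < m → m ≤ M → M < n → n ≤ N → G m n = H m n) :
    sumAcross M N G = sumAcross M N H := by
  refine Finset.sum_congr rfl fun m hm => Finset.sum_congr rfl fun n hn => ?_
  rw [Finset.mem_Ioc] at hm hn
  exact h m n hm.1 hm.2 hn.1 hn.2

lemma sumAcross_sum {ι : Type*} (s : Finset ι) (M N : ℕ) (G : ι → ℕ → ℕ → ℂ) :
    sumAcross M N (fun m n => ∑ i ∈ s, G i m n) = ∑ i ∈ s, sumAcross M N (G i) :=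
  (Finset.sum_congr rfl fun _ _ => Finset.sum_comm).trans Finset.sum_comm

lemma sumAcross_const_mul (c : ℂ) (M N : ℕ) (G : ℕ → ℕ → ℂ) :
    sumAcross M N (fun m n => c * G m n) = c * sumAcross M N G := by
  simp only [sumAcross, Finset.mul_sum]

lemma sum_Ioc_ite_dvd {l : ℕ} (hl : 0 < l) (A B : ℕ) (F : ℕ → ℂ) :
    ∑ m ∈ Finset.Ioc A B, (if l ∣ m then F m else 0) =
      ∑ m ∈ Finset.Ioc (A / l) (B / l), F (l * m) := by
  rw [← Finset.sum_filter]
  symm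
  refine Finset.sum_bij (fun m _ => l * m) ?_ ?_ ?_ ?_
  · intro m hm
    rw [Finset.mem_Ioc, Nat.div_lt_iff_lt_mul hl, Nat.le_div_iff_mul_le hl] at hm
    rw [Finset.mem_filter, Finset.mem_Ioc, mul_comm l m]
    exact ⟨hm, Dvd.intro_left _ rfl⟩
  · intro m _ m' _ h
    exact Nat.eq_of_mul_eq_mul_left hl h
  · intro n hn
    rw [Finset.mem_filter] at hn
    obtain ⟨hn, m, rfl⟩ := hn
    refine ⟨m, ?_, rfl⟩
    rw [Finset.mem_Ioc, mul_comm l m] at hn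
    rwa [Finset.mem_Ioc, Nat.div_lt_iff_lt_mul hl, Nat.le_div_iff_mul_le hl]
  · intro m _
    rfl

lemma sumAcross_ite_dvd {l : ℕ} (hl : 0 < l) (M N : ℕ) (G : ℕ → ℕ → ℂ) :
    sumAcross M N (fun m n => if l ∣ m ∧ l ∣ n then G m n else 0) =
      sumAcross (M / l) (N / l) (fun m n => G (l * m) (l * n)) := by
  unfold sumAcross
  rw [← Nat.zero_div l, ← sum_Ioc_ite_dvd hl 0 M
    (fun m => ∑ n ∈ Finset.Ioc (M / l) (N / l), G m (l * n)), Nat.zero_div]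
  refine Finset.sum_congr rfl fun m _ => ?_
  by_cases h : l ∣ m
  · simp only [h, true_and, if_true]
    exact sum_Ioc_ite_dvd hl M N (G m)
  · simp [h]

/-! ### From moduli e to complementary moduli f. -/

open ArithmeticFunction in
lemma totient_eq_mul_sum_moebius (n : ℕ) (hn : n ≠ 0) :
    (Nat.totient n : ℂ) = n * ∑ k ∈ n.divisors, (moebius k : ℂ) / k := by
  have h := (sum_eq_iff_sum_mul_moebius_eq (f := fun n => (Nat.totient n : ℂ))
    (g := fun n => (n : ℂ))).mp (fun m _ => by exact_mod_cast Nat.sum_totient m) n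
      (Nat.pos_of_ne_zero hn)
  rw [← h, Nat.sum_divisorsAntidiagonal (fun a b => (moebius a : ℂ) * (b : ℂ)), Finset.mul_sum]
  refine Finset.sum_congr rfl fun k hk => ?_
  have hk0 : (k : ℂ) ≠ 0 := by
    exact_mod_cast (Nat.pos_of_mem_divisors hk).ne'
  rw [Nat.cast_div (Nat.dvd_of_mem_divisors hk) hk0]
  ring

open ArithmeticFunction in
/-- The dependence of `φ(e) / φ(de)` on `e` expressed through the common divisors of `d`, `e`. -/
lemma totient_div_totient_mul {d e : ℕ} (hd : d ≠ 0) (he : e ≠ 0) :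
    (Nat.totient e : ℂ) / Nat.totient (d * e) =
      (Nat.totient d : ℂ)⁻¹ *
        ∑ k ∈ d.divisors, (moebius k : ℂ) / k * (if k ∣ e then 1 else 0) := by
  have h1 : ∑ k ∈ d.divisors, (moebius k : ℂ) / k * (if k ∣ e then 1 else 0) =
      ∑ k ∈ (d.gcd e).divisors, (moebius k : ℂ) / k := by
    simp only [mul_ite, mul_one, mul_zero]
    rw [← Finset.sum_filter]
    refine Finset.sum_congr ?_ fun _ _ => rfl
    ext k
    simp only [Finset.mem_filter, Nat.mem_divisors, Nat.dvd_gcd_iff]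
    have : d.gcd e ≠ 0 := Nat.gcd_ne_zero_left hd
    tauto
  have hg : d.gcd e ≠ 0 := Nat.gcd_ne_zero_left hd
  have hg' : ((d.gcd e : ℕ) : ℂ) ≠ 0 := by exact_mod_cast hg
  have h2 := totient_eq_mul_sum_moebius _ hg
  have h3 : ((d.gcd e).totient : ℂ) * (d * e).totient = d.totient * e.totient * (d.gcd e : ℕ) := by
    exact_mod_cast Nat.totient_gcd_mul_totient_mul d e
  have hdt : (Nat.totient d : ℂ) ≠ 0 := by
    exact_mod_cast (Nat.totient_pos.mpr (Nat.pos_of_ne_zero hd)).ne'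
  have hdet : (Nat.totient (d * e) : ℂ) ≠ 0 := by
    exact_mod_cast (Nat.totient_pos.mpr (Nat.pos_of_ne_zero (mul_ne_zero hd he))).ne'
  rw [h1]
  rw [h2] at h3
  rw [div_eq_iff hdet, mul_assoc, eq_inv_mul_iff_mul_eq₀ hdt]
  apply mul_left_cancel₀ hg'
  linear_combination -h3

-- The range of l is fixed by M rather than m, so that the sum over l can be moved outside the one
-- over m.
open ArithmeticFunction in
lemma ite_coprime_eq_sum_moebius {m e M : ℕ} (hm : 0 < m) (hmM : m ≤ M) :
    (if m.Coprime e then (1 : ℂ) else 0) =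
      ∑ l ∈ Finset.Ioc 0 M, if l ∣ m ∧ l ∣ e then (moebius l : ℂ) else 0 := by
  have h := sum_divisors_moebius (m.gcd e)
  rw [show (if m.Coprime e then (1 : ℂ) else 0) = if m.gcd e = 1 then 1 else 0 from
    if_congr Iff.rfl rfl rfl, ← h, ← Finset.sum_filter]
  refine Finset.sum_congr ?_ fun _ _ => rfl
  ext l
  simp only [Finset.mem_filter, Nat.mem_divisors, Nat.dvd_gcd_iff, Finset.mem_Ioc]
  have : m.gcd e ≠ 0 := Nat.gcd_ne_zero_left hm.ne'
  constructor
  · rintro ⟨⟨h1, h2⟩, _⟩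
    exact ⟨⟨Nat.pos_of_dvd_of_pos h1 hm, (Nat.le_of_dvd hm h1).trans hmM⟩, h1, h2⟩
  · rintro ⟨_, h1, h2⟩
    exact ⟨⟨h1, h2⟩, this⟩

lemma coprime_iff_of_modEq {d e m n : ℕ} (h : m ≡ n [MOD e]) :
    (m.Coprime (d * e) ∧ n.Coprime (d * e)) ↔ (m.Coprime d ∧ n.Coprime d) ∧ m.Coprime e := by
  have : m.Coprime e ↔ n.Coprime e := by
    rw [Nat.Coprime, Nat.Coprime, h.gcd_eq]
  rw [Nat.coprime_mul_iff_right, Nat.coprime_mul_iff_right]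
  tauto

open ArithmeticFunction in
/-- Removal of the coprimality condition to the modulus `e`. -/
lemma sum_modulus_eq_sum_common_divisor {d k m n M E : ℕ} (hk : k ∣ d) (hm : 0 < m) (hmM : m ≤ M)
    (w : ℝ → ℂ) :
    ∑ e ∈ Finset.Ioc 0 E, (if k ∣ e then (1 : ℂ) else 0) *
        (if (m.Coprime (d * e) ∧ n.Coprime (d * e)) ∧ m ≡ n [MOD e] then 1 else 0) * w e =
      ∑ l ∈ Finset.Ioc 0 M, (if l.Coprime d then (moebius l : ℂ) else 0) *
        (if l ∣ m ∧ l ∣ n then (if (m / l).Coprime d ∧ (n / l).Coprime d then (1 : ℂ) else 0) *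
          ∑ e ∈ Finset.Ioc 0 (E / l),
            (if k ∣ e ∧ m / l ≡ n / l [MOD e] then w ((l : ℝ) * e) else 0) else 0) := by
  by_cases hc : m.Coprime d ∧ n.Coprime d
  swap
  · rw [Finset.sum_eq_zero, Finset.sum_eq_zero]
    · intro l _
      by_cases h1 : l.Coprime d
      · by_cases h2 : l ∣ m ∧ l ∣ n
        · rw [if_neg (c := (m / l).Coprime d ∧ (n / l).Coprime d)]
          · simp
          · rintro ⟨h3, h4⟩
            apply hc
            constructor
            · rw [← Nat.mul_div_cancel' h2.1]; exact Nat.Coprime.mul_left h1 h3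
            · rw [← Nat.mul_div_cancel' h2.2]; exact Nat.Coprime.mul_left h1 h4
        · rw [if_neg h2, mul_zero]
      · rw [if_neg h1, zero_mul]
    · intro e _
      rw [if_neg (c := (m.Coprime (d * e) ∧ n.Coprime (d * e)) ∧ m ≡ n [MOD e])]
      · simp
      · rintro ⟨h1, h2⟩
        exact hc ((coprime_iff_of_modEq h2).mp h1).1
  have h1 : ∀ e ∈ Finset.Ioc 0 E, (if k ∣ e then (1 : ℂ) else 0) *
        (if (m.Coprime (d * e) ∧ n.Coprime (d * e)) ∧ m ≡ n [MOD e] then 1 else 0) * w e =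
      ∑ l ∈ Finset.Ioc 0 M, if l ∣ m ∧ l ∣ e then
        (if k ∣ e ∧ m ≡ n [MOD e] then (moebius l : ℂ) * w e else 0) else 0 := by
    intro e _
    by_cases h2 : k ∣ e ∧ m ≡ n [MOD e]
    · have h3 : ((m.Coprime (d * e) ∧ n.Coprime (d * e)) ∧ m ≡ n [MOD e]) ↔ m.Coprime e := by
        rw [coprime_iff_of_modEq h2.2]
        exact ⟨fun h => h.1.2, fun h => ⟨⟨hc, h⟩, h2.2⟩⟩
      rw [if_pos h2.1, one_mul, if_congr h3 rfl rfl, ite_coprime_eq_sum_moebius hm hmM,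
        Finset.sum_mul]
      refine Finset.sum_congr rfl fun l _ => ?_
      rw [if_pos h2]
      split_ifs <;> simp
    · have : (if k ∣ e then (1 : ℂ) else 0) *
        (if (m.Coprime (d * e) ∧ n.Coprime (d * e)) ∧ m ≡ n [MOD e] then 1 else 0) = 0 := by
        rw [not_and_or] at h2
        rcases h2 with h2 | h2
        · rw [if_neg h2, zero_mul]
        · rw [if_neg (c := (m.Coprime (d * e) ∧ n.Coprime (d * e)) ∧ m ≡ n [MOD e])
            fun h => h2 h.2, mul_zero]
      rw [this, zero_mul]
      simp [h2]
  rw [Finset.sum_congr rfl h1, Finset.sum_comm]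
  refine Finset.sum_congr rfl fun l hl => ?_
  have hl0 : 0 < l := (Finset.mem_Ioc.mp hl).1
  by_cases hlm : l ∣ m
  swap
  · simp [hlm]
  -- Since l ∣ m is coprime to d, it is coprime to k ∣ d, and k ∣ l e reduces to k ∣ e.
  have hld : l.Coprime d := Nat.Coprime.coprime_dvd_left hlm hc.1
  have hlk : k.Coprime l := (Nat.Coprime.coprime_dvd_right hk hld).symm
  simp only [hlm, true_and, if_pos hld]
  rw [sum_Ioc_ite_dvd hl0, Nat.zero_div]
  by_cases hln : l ∣ n
  · obtain ⟨m', rfl⟩ := hlm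
    obtain ⟨n', rfl⟩ := hln
    have h3 : (l * m' / l).Coprime d ∧ (l * n' / l).Coprime d := by
      rw [Nat.mul_div_cancel_left _ hl0, Nat.mul_div_cancel_left _ hl0]
      exact ⟨Nat.Coprime.coprime_dvd_left (Dvd.intro_left _ rfl) hc.1,
        Nat.Coprime.coprime_dvd_left (Dvd.intro_left _ rfl) hc.2⟩
    rw [if_pos (Dvd.intro _ rfl), if_pos h3, one_mul, Finset.mul_sum,
      Nat.mul_div_cancel_left _ hl0, Nat.mul_div_cancel_left _ hl0]
    refine Finset.sum_congr rfl fun e _ => ?_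
    rw [mul_ite, mul_zero, Nat.cast_mul]
    refine if_congr ?_ rfl rfl
    rw [Nat.Coprime.dvd_mul_left hlk]
    have : l * m' ≡ l * n' [MOD l * e] ↔ m' ≡ n' [MOD e] :=
      ⟨fun h => Nat.ModEq.mul_left_cancel' hl0.ne' h, fun h => Nat.ModEq.mul_left' l h⟩
    rw [this]
  · rw [if_neg hln, mul_zero]
    refine Finset.sum_eq_zero fun e _ => ?_
    rw [if_neg]
    -- The congruence modulo l e would pass the divisibility by l from m to n.
    rintro ⟨_, h⟩
    exact hln (((h.of_mul_right e).dvd_iff dvd_rfl).mp hlm)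

/-- The switch from a divisor `e` of `n - m` to the complementary divisor `f`. -/
lemma sum_divisor_eq_sum_complementary {k m n E F : ℕ} (hmn : m < n) (w : ℝ → ℂ) {x : ℝ}
    (hE : ∀ e : ℕ, E < e → w (x * e) = 0)
    (hF : ∀ f : ℕ, F < f → w (x * (((n : ℝ) - m) / f)) = 0) :
    ∑ e ∈ Finset.Ioc 0 E, (if k ∣ e ∧ m ≡ n [MOD e] then w (x * e) else 0) =
      ∑ f ∈ Finset.Ioc 0 F, (if m ≡ n [MOD k * f] then w (x * (((n : ℝ) - m) / f)) else 0) := by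
  have hh : n - m ≠ 0 := by omega
  -- Both sides become sums over all divisors of n - m, the extra terms being zero by `hE` and `hF`;
  -- the involution e ↦ (n - m)/e then matches them.
  have h1 : ∑ e ∈ Finset.Ioc 0 E, (if k ∣ e ∧ m ≡ n [MOD e] then w (x * e) else 0) =
      ∑ e ∈ (n - m).divisors, (if k ∣ e then w (x * e) else 0) := by
    have : ∀ e ∈ Finset.Ioc 0 E, (if k ∣ e ∧ m ≡ n [MOD e] then w (x * e) else 0) =
        if m ≡ n [MOD e] then (if k ∣ e then w (x * e) else 0) else 0 := by
      intro e _
      split_ifs <;> first | rfl | tauto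
    rw [Finset.sum_congr rfl this, ← Finset.sum_filter]
    refine Finset.sum_subset_zero_on_sdiff ?_ ?_ (fun _ _ => rfl)
    · intro e he
      rw [Finset.mem_filter, Nat.modEq_iff_dvd' hmn.le] at he
      exact Nat.mem_divisors.mpr ⟨he.2, hh⟩
    · intro e he
      rw [Finset.mem_sdiff, Nat.mem_divisors, Finset.mem_filter, Nat.modEq_iff_dvd' hmn.le,
        Finset.mem_Ioc] at he
      rw [hE e, ite_self]
      by_contra h
      exact he.2 ⟨⟨Nat.pos_of_dvd_of_pos he.1.1 (Nat.pos_of_ne_zero hh), by omega⟩, he.1.1⟩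
  have h2 : ∑ f ∈ Finset.Ioc 0 F,
      (if m ≡ n [MOD k * f] then w (x * (((n : ℝ) - m) / f)) else 0) =
      ∑ f ∈ (n - m).divisors, (if k * f ∣ n - m then w (x * (((n : ℝ) - m) / f)) else 0) := by
    have : ∀ f ∈ Finset.Ioc 0 F, (if m ≡ n [MOD k * f] then w (x * (((n : ℝ) - m) / f)) else 0) =
        if f ∣ n - m then (if k * f ∣ n - m then w (x * (((n : ℝ) - m) / f)) else 0) else 0 := by
      intro f _
      rw [if_congr (Nat.modEq_iff_dvd' hmn.le) rfl rfl]
      by_cases h3 : k * f ∣ n - m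
      · rw [if_pos h3, if_pos (dvd_of_mul_left_dvd h3)]
      · simp [h3]
    rw [Finset.sum_congr rfl this, ← Finset.sum_filter]
    refine Finset.sum_subset_zero_on_sdiff ?_ ?_ (fun _ _ => rfl)
    · intro f hf
      rw [Finset.mem_filter] at hf
      exact Nat.mem_divisors.mpr ⟨hf.2, hh⟩
    · intro f hf
      rw [Finset.mem_sdiff, Nat.mem_divisors, Finset.mem_filter, Finset.mem_Ioc] at hf
      rw [hF f, ite_self]
      by_contra h
      exact hf.2 ⟨⟨Nat.pos_of_dvd_of_pos hf.1.1 (Nat.pos_of_ne_zero hh), by omega⟩, hf.1.1⟩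
  rw [h1, h2, ← Nat.sum_div_divisors (n - m) (fun e => if k ∣ e then w (x * e) else 0)]
  refine Finset.sum_congr rfl fun f hf => ?_
  obtain ⟨t, ht⟩ := Nat.dvd_of_mem_divisors hf
  have hf0 : 0 < f := Nat.pos_of_mem_divisors hf
  have hcast : ((n : ℝ) - m) = f * t := by
    rw [← Nat.cast_sub hmn.le, ht, Nat.cast_mul]
  rw [ht, Nat.mul_div_cancel_left _ hf0, hcast,
    mul_div_cancel_left₀ _ (by exact_mod_cast hf0.ne' : (f : ℝ) ≠ 0), mul_comm f t]
  exact if_congr (Nat.mul_dvd_mul_iff_right hf0).symm rfl rfl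

/-- Decomposition of a congruence modulo `k f` according to the common divisor with `f`. -/
lemma ite_modEq_eq_sum_divisors {d k f m n : ℕ} (hf : 0 < f) :
    (if (m.Coprime d ∧ n.Coprime d) ∧ m ≡ n [MOD k * f] then (1 : ℂ) else 0) =
      ∑ g ∈ f.divisors, (if g.Coprime d then (1 : ℂ) else 0) * (if g ∣ m ∧ g ∣ n then
        (if ((m / g).Coprime (d * (f / g)) ∧ (n / g).Coprime (d * (f / g))) ∧
          m / g ≡ n / g [MOD k * (f / g)] then 1 else 0) else 0) := by
  -- Only g = gcd(m, f) survives; the congruence modulo f makes it equal to gcd(n, f) as well.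
  have hterm : ∀ g ∈ f.divisors, (if g.Coprime d then (1 : ℂ) else 0) * (if g ∣ m ∧ g ∣ n then
        (if ((m / g).Coprime (d * (f / g)) ∧ (n / g).Coprime (d * (f / g))) ∧
          m / g ≡ n / g [MOD k * (f / g)] then 1 else 0) else 0) =
      if g = m.gcd f then
        (if (m.Coprime d ∧ n.Coprime d) ∧ m ≡ n [MOD k * f] then (1 : ℂ) else 0) else 0 := by
    intro g hg
    obtain ⟨f', rfl⟩ := Nat.dvd_of_mem_divisors hg
    have hg0 : 0 < g := Nat.pos_of_mem_divisors hg
    rw [Nat.mul_div_cancel_left _ hg0, ite_mul, one_mul, zero_mul, ← ite_and, ← ite_and,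
      ← ite_and]
    refine if_congr ?_ rfl rfl
    have hmul : ∀ {a b : ℕ}, g * a ≡ g * b [MOD k * (g * f')] ↔ a ≡ b [MOD k * f'] := by
      intro a b
      rw [show k * (g * f') = g * (k * f') by ring]
      exact ⟨fun h => Nat.ModEq.mul_left_cancel' hg0.ne' h, fun h => Nat.ModEq.mul_left' g h⟩
    constructor
    · rintro ⟨⟨hgd, ⟨m', rfl⟩, ⟨n', rfl⟩⟩, ⟨hm, hn⟩, hmn⟩
      rw [Nat.mul_div_cancel_left _ hg0] at hm hmn
      rw [Nat.mul_div_cancel_left _ hg0] at hn hmn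
      rw [Nat.coprime_mul_iff_right] at hm hn
      refine ⟨?_, ⟨Nat.Coprime.mul_left hgd hm.1, Nat.Coprime.mul_left hgd hn.1⟩, hmul.mpr hmn⟩
      rw [Nat.gcd_mul_left, hm.2, mul_one]
    · rintro ⟨hgm, ⟨hm, hn⟩, hmn⟩
      have hmn' : m ≡ n [MOD g * f'] := hmn.of_mul_left k
      have hgn : g = n.gcd (g * f') := hgm.trans hmn'.gcd_eq
      have hdm : g ∣ m := by rw [hgm]; exact Nat.gcd_dvd_left _ _
      have hdn : g ∣ n := by rw [hgn]; exact Nat.gcd_dvd_left _ _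
      obtain ⟨m', rfl⟩ := hdm
      obtain ⟨n', rfl⟩ := hdn
      rw [Nat.gcd_mul_left] at hgm hgn
      have hm1 : m'.Coprime f' := (Nat.mul_eq_left hg0.ne').mp hgm.symm
      have hn1 : n'.Coprime f' := (Nat.mul_eq_left hg0.ne').mp hgn.symm
      refine ⟨⟨Nat.Coprime.coprime_dvd_left (Dvd.intro _ rfl) hm,
        Dvd.intro _ rfl, Dvd.intro _ rfl⟩, ?_⟩
      rw [Nat.mul_div_cancel_left _ hg0, Nat.mul_div_cancel_left _ hg0]
      exact ⟨⟨Nat.Coprime.mul_right (Nat.Coprime.coprime_dvd_left (Dvd.intro_left _ rfl) hm) hm1,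
        Nat.Coprime.mul_right (Nat.Coprime.coprime_dvd_left (Dvd.intro_left _ rfl) hn) hn1⟩,
        hmul.mp hmn⟩
  rw [Finset.sum_congr rfl hterm, Finset.sum_ite_eq',
    if_pos (Nat.mem_divisors.mpr ⟨Nat.gcd_dvd_right m f, hf.ne'⟩)]

open ArithmeticFunction in
/-- The sum over moduli `e`, transformed into a sum over complementary moduli. -/
lemma sumAcross_modulus_eq {d k M N E F : ℕ} (hk : k ∣ d) (a b : ℕ → ℂ) (w : ℝ → ℂ)
    (hE : ∀ x : ℝ, E + 1 ≤ x → w x = 0) (hF : ∀ x : ℝ, x * (F + 1) ≤ N → w x = 0) :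
    sumAcross M N (fun m n => a m * b n * ∑ e ∈ Finset.Ioc 0 E, (if k ∣ e then (1 : ℂ) else 0) *
        (if (m.Coprime (d * e) ∧ n.Coprime (d * e)) ∧ m ≡ n [MOD e] then 1 else 0) * w e) =
      ∑ l ∈ Finset.Ioc 0 M, (if l.Coprime d then (moebius l : ℂ) else 0) *
        ∑ f ∈ Finset.Ioc 0 F, ∑ g ∈ f.divisors, (if g.Coprime d then (1 : ℂ) else 0) *
          sumAcross (M / (l * g)) (N / (l * g)) (fun m n =>
            a (m * (l * g)) * b (n * (l * g)) *
            ((if (m.Coprime (d * (f / g)) ∧ n.Coprime (d * (f / g))) ∧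
              m ≡ n [MOD k * (f / g)] then 1 else 0) *
              w (((l * g : ℕ) : ℝ) / f * ((n : ℝ) - m)))) := by
  have h1 : sumAcross M N (fun m n => a m * b n * ∑ e ∈ Finset.Ioc 0 E,
        (if k ∣ e then (1 : ℂ) else 0) *
        (if (m.Coprime (d * e) ∧ n.Coprime (d * e)) ∧ m ≡ n [MOD e] then 1 else 0) * w e) =
      sumAcross M N (fun m n => ∑ l ∈ Finset.Ioc 0 M,
        (if l.Coprime d then (moebius l : ℂ) else 0) *
        (if l ∣ m ∧ l ∣ n then a m * b n *
          ((if (m / l).Coprime d ∧ (n / l).Coprime d then (1 : ℂ) else 0) *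
          ∑ e ∈ Finset.Ioc 0 (E / l),
            (if k ∣ e ∧ m / l ≡ n / l [MOD e] then w ((l : ℝ) * e) else 0)) else 0)) := by
    refine sumAcross_congr fun m n hm hmM _ _ => ?_
    rw [sum_modulus_eq_sum_common_divisor hk hm hmM, Finset.mul_sum]
    refine Finset.sum_congr rfl fun l _ => ?_
    split_ifs <;> ring
  rw [h1, sumAcross_sum]
  refine Finset.sum_congr rfl fun l hl => ?_
  have hl0 : 0 < l := (Finset.mem_Ioc.mp hl).1
  rw [sumAcross_const_mul, sumAcross_ite_dvd hl0]
  congr 1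
  have h2 : sumAcross (M / l) (N / l) (fun m n => a (l * m) * b (l * n) *
          ((if (l * m / l).Coprime d ∧ (l * n / l).Coprime d then (1 : ℂ) else 0) *
          ∑ e ∈ Finset.Ioc 0 (E / l),
            (if k ∣ e ∧ l * m / l ≡ l * n / l [MOD e] then w ((l : ℝ) * e) else 0))) =
      sumAcross (M / l) (N / l) (fun m n => ∑ f ∈ Finset.Ioc 0 F, ∑ g ∈ f.divisors,
        (if g.Coprime d then (1 : ℂ) else 0) * (if g ∣ m ∧ g ∣ n then
          a (l * m) * b (l * n) *
        ((if ((m / g).Coprime (d * (f / g)) ∧ (n / g).Coprime (d * (f / g))) ∧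
          m / g ≡ n / g [MOD k * (f / g)] then 1 else 0) *
          w (l * (((n : ℝ) - m) / f))) else 0)) := by
    refine sumAcross_congr fun m n hm hmM hn hnN => ?_
    have hmn : m < n := hmM.trans_lt hn
    rw [Nat.mul_div_cancel_left _ hl0, Nat.mul_div_cancel_left _ hl0,
      sum_divisor_eq_sum_complementary (F := F) hmn w]
    · rw [Finset.mul_sum, Finset.mul_sum]
      refine Finset.sum_congr rfl fun f hf => ?_
      have hf0 : 0 < f := (Finset.mem_Ioc.mp hf).1
      have h3 : (if m.Coprime d ∧ n.Coprime d then (1 : ℂ) else 0) *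
          (if m ≡ n [MOD k * f] then w (l * (((n : ℝ) - m) / f)) else 0) =
          (if (m.Coprime d ∧ n.Coprime d) ∧ m ≡ n [MOD k * f] then (1 : ℂ) else 0) *
            w (l * (((n : ℝ) - m) / f)) := by
        rw [ite_zero_mul_ite_zero, ite_mul, zero_mul]
      rw [h3, ite_modEq_eq_sum_divisors hf0, Finset.sum_mul, Finset.mul_sum]
      refine Finset.sum_congr rfl fun g _ => ?_
      split_ifs <;> ring
    · intro e he
      apply hE
      rw [Nat.div_lt_iff_lt_mul hl0, mul_comm] at he
      exact_mod_cast he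
    -- Here f > F, and l (n - m) ≤ N forces the argument of w below N / (F + 1), where w vanishes.
    · intro f hf
      apply hF
      have hf1 : (F : ℝ) + 1 ≤ f := by exact_mod_cast hf
      have hf0 : (0 : ℝ) < f := by linarith [(Nat.cast_nonneg F : (0 : ℝ) ≤ F)]
      have hmn' : (m : ℝ) ≤ n := by exact_mod_cast hmn.le
      have hln : (l : ℝ) * n ≤ N := by
        rw [Nat.le_div_iff_mul_le hl0, mul_comm] at hnN
        exact_mod_cast hnN
      have h0 : 0 ≤ (l : ℝ) * (((n : ℝ) - m) / f) :=
        mul_nonneg (Nat.cast_nonneg _) (div_nonneg (by linarith) hf0.le)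
      calc (l : ℝ) * (((n : ℝ) - m) / f) * (F + 1) ≤ (l : ℝ) * (((n : ℝ) - m) / f) * f :=
            mul_le_mul_of_nonneg_left hf1 h0
        _ = l * ((n : ℝ) - m) := by field_simp
        _ ≤ l * n := by
          apply mul_le_mul_of_nonneg_left _ (Nat.cast_nonneg _)
          linarith [(Nat.cast_nonneg m : (0 : ℝ) ≤ m)]
        _ ≤ N := hln
  rw [h2, sumAcross_sum]
  refine Finset.sum_congr rfl fun f _ => ?_
  rw [sumAcross_sum]
  refine Finset.sum_congr rfl fun g hg => ?_
  have hg0 : 0 < g := Nat.pos_of_mem_divisors hg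
  rw [sumAcross_const_mul, sumAcross_ite_dvd hg0, Nat.div_div_eq_div_mul, Nat.div_div_eq_div_mul]
  congr 1
  refine sumAcross_congr fun m n _ _ _ _ => ?_
  rw [Nat.mul_div_cancel_left _ hg0, Nat.mul_div_cancel_left _ hg0,
    show l * (g * m) = m * (l * g) by ring, show l * (g * n) = n * (l * g) by ring]
  congr 3
  push_cast
  ring

/-! ### Summing the bounds over l, f and g. -/

/-- The sum of the reciprocals of the first `n` positive integers. -/
noncomputable def harmonicSum (n : ℕ) : ℝ := ∑ i ∈ Finset.Ioc 0 n, (i : ℝ)⁻¹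

lemma harmonicSum_nonneg (n : ℕ) : 0 ≤ harmonicSum n :=
  Finset.sum_nonneg fun _ _ => by positivity

lemma harmonicSum_mono {m n : ℕ} (h : m ≤ n) : harmonicSum m ≤ harmonicSum n :=
  Finset.sum_le_sum_of_subset_of_nonneg (Finset.Ioc_subset_Ioc_right h) fun _ _ _ => by positivity

lemma harmonicSum_le (n : ℕ) : harmonicSum n ≤ 1 + Real.log n := by
  have := harmonic_le_one_add_log n
  rw [harmonic_eq_sum_Icc] at this
  push_cast at this
  exact this

lemma sum_divisors_inv_le (n : ℕ) : ∑ k ∈ n.divisors, (k : ℝ)⁻¹ ≤ harmonicSum n := by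
  refine Finset.sum_le_sum_of_subset_of_nonneg (fun k hk => ?_) fun _ _ _ => by positivity
  exact Finset.mem_Ioc.mpr ⟨Nat.pos_of_mem_divisors hk, Nat.divisor_le hk⟩

open ArithmeticFunction in
lemma norm_ite_moebius_le_one (p : Prop) [Decidable p] (l : ℕ) :
    ‖(if p then (moebius l : ℂ) else 0)‖ ≤ 1 := by
  split_ifs
  · rw [Complex.norm_intCast]
    exact_mod_cast abs_moebius_le_one
  · simp

/-- A bound c / (lg) for each inner form costs only logarithms in l and g; the one real loss is the
number F of complementary moduli. -/
lemma norm_sumAcross_modulus_le {d k M N E F : ℕ} (hk : k ∣ d) (a b : ℕ → ℂ) (w : ℝ → ℂ)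
    (hE : ∀ x : ℝ, E + 1 ≤ x → w x = 0) (hF : ∀ x : ℝ, x * (F + 1) ≤ N → w x = 0)
    {c : ℝ} (hc : 0 ≤ c)
    (h : ∀ l f g : ℕ, 0 < l → 0 < g → 0 < f → g ∣ f → f ≤ F →
      ‖sumAcross (M / (l * g)) (N / (l * g)) (fun m n =>
            a (m * (l * g)) * b (n * (l * g)) *
            ((if (m.Coprime (d * (f / g)) ∧ n.Coprime (d * (f / g))) ∧
              m ≡ n [MOD k * (f / g)] then 1 else 0) *
              w (((l * g : ℕ) : ℝ) / f * ((n : ℝ) - m))))‖ ≤ c * ((l * g : ℕ) : ℝ)⁻¹) :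
    ‖sumAcross M N (fun m n => a m * b n * ∑ e ∈ Finset.Ioc 0 E,
        (if k ∣ e then (1 : ℂ) else 0) *
        (if (m.Coprime (d * e) ∧ n.Coprime (d * e)) ∧ m ≡ n [MOD e] then 1 else 0) * w e)‖ ≤
      c * harmonicSum M * (F * harmonicSum F) := by
  rw [sumAcross_modulus_eq hk a b w hE hF]
  refine (norm_sum_le _ _).trans ?_
  have hrhs : c * harmonicSum M * (F * harmonicSum F) =
      ∑ l ∈ Finset.Ioc 0 M, ∑ f ∈ Finset.Ioc 0 F, c * (l : ℝ)⁻¹ * harmonicSum F := by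
    simp only [Finset.sum_const, nsmul_eq_mul, Nat.card_Ioc, Nat.sub_zero]
    rw [harmonicSum, Finset.mul_sum, Finset.sum_mul]
    exact Finset.sum_congr rfl fun _ _ => by ring
  rw [hrhs]
  refine Finset.sum_le_sum fun l hl => ?_
  have hl0 : 0 < l := (Finset.mem_Ioc.mp hl).1
  rw [norm_mul]
  refine (mul_le_of_le_one_left (norm_nonneg _) (norm_ite_moebius_le_one _ _)).trans ?_
  refine (norm_sum_le _ _).trans (Finset.sum_le_sum fun f hf => ?_)
  rw [Finset.mem_Ioc] at hf
  refine (norm_sum_le _ _).trans ?_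
  refine le_trans ?_ (mul_le_mul_of_nonneg_left
    ((sum_divisors_inv_le f).trans (harmonicSum_mono hf.2)) (by positivity))
  rw [Finset.mul_sum]
  refine Finset.sum_le_sum fun g hg => ?_
  have h1 := h l f g hl0 (Nat.pos_of_mem_divisors hg) hf.1 (Nat.dvd_of_mem_divisors hg) hf.2
  rw [norm_mul]
  refine (mul_le_of_le_one_left (norm_nonneg _) ?_).trans (h1.trans (le_of_eq ?_))
  · split_ifs <;> simp
  · push_cast
    rw [mul_inv]
    ring

/-! ### Consequences of the hypotheses on a and b. -/

lemma charA_eq_sum_Ioc (X : ℝ) (a : ℕ → ℂ) {q : ℕ} (χ : DirichletCharacter ℂ q) :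
    charA X a χ = ∑ m ∈ Finset.Ioc 0 ⌊X⌋₊, a m * χ (m : ZMod q) := rfl

lemma norm_sum_mul_char_le {Q X ε : ℝ} {C : ℝ → ℝ} {a : ℕ → ℂ} (ha : PartialSumBound Q X C a)
    (hX : 1 ≤ X) (hε : 0 < ε) {l L : ℕ} (hl : 1 ≤ l) (hlX : (l : ℝ) ≤ X) (hL : 1 ≤ L)
    (hLQ : (L : ℝ) ≤ 2 * Q) (χ : DirichletCharacter ℂ L) {j : ℕ} (hj : j ≤ ⌊X⌋₊ / l)
    (hC : 0 ≤ C ε * Q ^ ε) :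
    ‖∑ m ∈ Finset.Ioc 0 j, a (m * l) * χ (m : ZMod L)‖ ≤
      C ε * Q ^ ε * (X / l) ^ (1 / 2 : ℝ) := by
  have hl0 : (0 : ℝ) < l := by exact_mod_cast hl
  rcases Nat.eq_zero_or_pos j with rfl | hj0
  · simp only [Finset.Ioc_self, Finset.sum_empty, norm_zero]
    positivity
  have hjX : (j : ℝ) ≤ X / l := by
    rw [← Nat.floor_div_natCast] at hj
    exact (Nat.le_floor_iff (by positivity)).mp hj
  have h := ha ε hε 1 l L le_rfl (by simpa using hX) hl hlX hL hLQ χ j (by exact_mod_cast hj0) hjX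
  have h2 : coprimePartialSum a 1 l χ j = ∑ m ∈ Finset.Ioc 0 j, a (m * l) * χ (m : ZMod L) := by
    unfold coprimePartialSum
    rw [Nat.floor_natCast, Finset.filter_true_of_mem fun _ _ => Nat.coprime_one_right _]
    rfl
  rw [← h2]
  refine h.trans (mul_le_mul_of_nonneg_left ?_ hC)
  exact Real.rpow_le_rpow (Nat.cast_nonneg _) hjX (by norm_num)

lemma coprimeTailTerm_one (b : ℕ → ℂ) (l : ℕ) {q : ℕ} (ψ : DirichletCharacter ℂ q) (v : ℝ) :
    coprimeTailTerm b 1 l ψ v =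
      fun n : ℕ => if v < (n : ℝ) then b (n * l) * ψ (n : ZMod q) else 0 := by
  funext n
  simp [coprimeTailTerm]

/-- The difference of two tails of a convergent series is a finite sum. -/
lemma sum_Ioc_eq_sub_of_hasSum {f : ℕ → ℂ} {u v : ℝ} (hu : 0 ≤ u) (huv : u ≤ v) {s t : ℂ}
    (hs : HasSum (fun n : ℕ => if u < (n : ℝ) then f n else 0) s (SummationFilter.conditional ℕ))
    (ht : HasSum (fun n : ℕ => if v < (n : ℝ) then f n else 0) t (SummationFilter.conditional ℕ)) :
    ∑ n ∈ Finset.Ioc ⌊u⌋₊ ⌊v⌋₊, f n = s - t := by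
  have hv : 0 ≤ v := hu.trans huv
  have h1 := hs.sub ht
  have h2 : (fun n : ℕ => (if u < (n : ℝ) then f n else 0) - (if v < (n : ℝ) then f n else 0)) =
      fun n => if n ∈ Finset.Ioc ⌊u⌋₊ ⌊v⌋₊ then f n else 0 := by
    funext n
    have e1 : u < n ↔ ⌊u⌋₊ < n := (Nat.floor_lt hu).symm
    have e2 : v < n ↔ ⌊v⌋₊ < n := (Nat.floor_lt hv).symm
    have e3 : ⌊u⌋₊ ≤ ⌊v⌋₊ := Nat.floor_mono huv
    simp only [e1, e2, Finset.mem_Ioc]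
    by_cases h3 : ⌊v⌋₊ < n
    · simp [h3, e3.trans_lt h3, not_le.mpr h3]
    · simp [h3, not_lt.mp h3]
  rw [h2] at h1
  have h3 : HasSum (fun n => if n ∈ Finset.Ioc ⌊u⌋₊ ⌊v⌋₊ then f n else 0)
      (∑ n ∈ Finset.Ioc ⌊u⌋₊ ⌊v⌋₊, if n ∈ Finset.Ioc ⌊u⌋₊ ⌊v⌋₊ then f n else 0)
      (SummationFilter.conditional ℕ) :=
    hasSum_sum_of_ne_finset_zero fun n hn => if_neg hn
  rw [← h3.unique h1]
  exact Finset.sum_congr rfl fun n hn => (if_pos hn).symm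

/-- A finite block is the difference of two tails, both starting at or after X / l; hence the factor
2. -/
lemma norm_sum_Ioc_mul_char_le {Q X ε : ℝ} {C : ℝ → ℝ} {b : ℕ → ℂ} (hb : TailSumBound Q X C b)
    (hX : 1 ≤ X) (hε : 0 < ε) {l L : ℕ} (hl : 1 ≤ l) (hlX : (l : ℝ) ≤ X) (hL : 1 ≤ L)
    (hLQ : (L : ℝ) ≤ 2 * Q) (χ : DirichletCharacter ℂ L) {j : ℕ} (hj : ⌊X⌋₊ / l ≤ j)
    (hC : 0 ≤ C ε * Q ^ ε) :
    ‖∑ n ∈ Finset.Ioc (⌊X⌋₊ / l) j, b (n * l) * χ (n : ZMod L)‖ ≤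
      2 * (C ε * Q ^ ε * (l : ℝ)⁻¹ * (X / l) ^ (-(1 / 2) : ℝ)) := by
  have hl0 : (0 : ℝ) < l := by exact_mod_cast hl
  have hXl : 0 < X / l := by positivity
  rcases hj.eq_or_lt with rfl | hj
  · simp only [Finset.Ioc_self, Finset.sum_empty, norm_zero]
    positivity
  have hjX : X / l ≤ j := by
    rw [← Nat.floor_div_natCast] at hj
    exact ((Nat.floor_lt hXl.le).mp hj).le
  obtain ⟨s, hs, hs'⟩ := hb ε hε 1 l L le_rfl (by simpa using hX) hl hlX hL hLQ χ (X / l) le_rfl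
  obtain ⟨t, ht, ht'⟩ := hb ε hε 1 l L le_rfl (by simpa using hX) hl hlX hL hLQ χ j hjX
  rw [coprimeTailTerm_one] at hs ht
  have h := sum_Ioc_eq_sub_of_hasSum (f := fun n => b (n * l) * χ (n : ZMod L)) hXl.le hjX hs ht
  rw [Nat.floor_div_natCast, Nat.floor_natCast] at h
  rw [h, two_mul]
  refine (norm_sub_le _ _).trans (add_le_add ?_ ?_)
  · refine hs'.trans (le_of_eq ?_)
    ring
  · refine ht'.trans ?_
    have h3 : (j : ℝ) ^ (-(1 / 2) : ℝ) ≤ (X / l) ^ (-(1 / 2) : ℝ) :=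
      Real.rpow_le_rpow_of_nonpos hXl hjX (by norm_num)
    calc C ε * (l : ℝ)⁻¹ * Q ^ ε * (j : ℝ) ^ (-(1 / 2) : ℝ)
        = C ε * Q ^ ε * (l : ℝ)⁻¹ * (j : ℝ) ^ (-(1 / 2) : ℝ) := by ring
      _ ≤ _ := mul_le_mul_of_nonneg_left h3 (by positivity)

lemma norm_charA_le {Q X ε : ℝ} {C : ℝ → ℝ} {a : ℕ → ℂ} (ha : PartialSumBound Q X C a)
    (hX : 1 ≤ X) (hε : 0 < ε) {q : ℕ} (hq : 1 ≤ q) (hqQ : (q : ℝ) ≤ 2 * Q)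
    (χ : DirichletCharacter ℂ q) (hC : 0 ≤ C ε * Q ^ ε) :
    ‖charA X a χ‖ ≤ C ε * Q ^ ε * X ^ (1 / 2 : ℝ) := by
  have h := norm_sum_mul_char_le ha hX hε le_rfl (by simpa using hX) hq hqQ χ (j := ⌊X⌋₊)
    (by simp) hC
  rw [charA_eq_sum_Ioc]
  simpa using h

lemma norm_charB_sub_sum_le {Q X ε : ℝ} {C : ℝ → ℝ} {b : ℕ → ℂ} (hb : TailSumBound Q X C b)
    (hX : 1 ≤ X) (hε : 0 < ε) {q : ℕ} (hq : 1 ≤ q) (hqQ : (q : ℝ) ≤ 2 * Q)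
    (χ : DirichletCharacter ℂ q) {v : ℝ} (hv : X ≤ v) :
    ‖charB X b χ - ∑ n ∈ Finset.Ioc ⌊X⌋₊ ⌊v⌋₊, b n * χ (n : ZMod q)‖ ≤
      C ε * Q ^ ε * v ^ (-(1 / 2) : ℝ) := by
  obtain ⟨s, hs, -⟩ := hb ε hε 1 1 q le_rfl (by simpa using hX) le_rfl (by simpa using hX) hq hqQ χ
    X (by simp)
  obtain ⟨t, ht, ht'⟩ := hb ε hε 1 1 q le_rfl (by simpa using hX) le_rfl (by simpa using hX) hq hqQ
    χ v (by simpa using hv)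
  rw [coprimeTailTerm_one] at hs ht
  simp only [mul_one] at hs ht
  have h := sum_Ioc_eq_sub_of_hasSum (f := fun n => b n * χ (n : ZMod q)) (by linarith) hv hs ht
  have h2 : charB X b χ = s := hs.tsum_eq
  rw [h, h2, sub_sub_cancel]
  simpa using ht'

/-- The bilinear form with a congruence condition is bounded through the characters. -/
lemma norm_sumAcross_modEq_le {W : ℝ → ℝ} {w : ℝ} (hw0 : 0 ≤ w) (hW0 : ∀ x, |W x| ≤ w)
    (hW1 : ∀ x y, |W y - W x| ≤ w * |y - x|)
    (hW2 : ∀ x h : ℝ, |W (x + h) - W x - (W x - W (x - h))| ≤ w * h ^ 2)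
    (hWsupp : ∀ x, 2 < x → W x = 0) {Q X ε : ℝ} {C : ℝ → ℝ} {a b : ℕ → ℂ}
    (ha : PartialSumBound Q X C a) (hb : TailSumBound Q X C b)
    (hX : 1 ≤ X) (hε : 0 < ε) (hC : 0 ≤ C ε * Q ^ ε) {l L r N : ℕ} (hl : 1 ≤ l) (hL : 1 ≤ L)
    (hLQ : (L : ℝ) ≤ 2 * Q) (hr : r ∣ L) (hN : ⌊X⌋₊ ≤ N) {t : ℝ} (ht : 0 < t) :
    ‖sumAcross (⌊X⌋₊ / l) (N / l) (fun m n => a (m * l) * b (n * l) *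
      ((if (m.Coprime L ∧ n.Coprime L) ∧ m ≡ n [MOD r] then 1 else 0) *
        (W (t * ((n : ℝ) - m)) : ℂ)))‖ ≤ 18 * w * (C ε * Q ^ ε) ^ 2 * (l : ℝ)⁻¹ := by
  have hl0 : (0 : ℝ) < l := by exact_mod_cast hl
  by_cases hlX : (l : ℝ) ≤ X
  -- For l > X the hypotheses say nothing, but then there is no m to sum over.
  swap
  · have : ⌊X⌋₊ / l = 0 := Nat.div_eq_of_lt ((Nat.floor_lt (by linarith)).mpr (not_le.mp hlX))
    rw [this]
    simp only [sumAcross, Finset.Ioc_self, Finset.sum_empty, norm_zero]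
    positivity
  have hNeZ : NeZero L := ⟨by omega⟩
  have hr0 : 0 < r := Nat.pos_of_dvd_of_pos hr hL
  have hφ : (0 : ℝ) < r.totient := by exact_mod_cast Nat.totient_pos.mpr hr0
  have hXl : 0 < X / l := by positivity
  set Z := C ε * Q ^ ε with hZ
  -- The φ(r) characters modulo L of conductor dividing r detect the congruence modulo r together
  -- with coprimality to L. Each contributes the same bound, so the factor φ(r) cancels.
  have h1 : (r.totient : ℂ) * sumAcross (⌊X⌋₊ / l) (N / l) (fun m n => a (m * l) * b (n * l) *
      ((if (m.Coprime L ∧ n.Coprime L) ∧ m ≡ n [MOD r] then 1 else 0) *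
        (W (t * ((n : ℝ) - m)) : ℂ))) = ∑ χ ∈ charsOfConductorDvd L r,
      sumAcross (⌊X⌋₊ / l) (N / l) (fun m n => (a (m * l) * χ (m : ZMod L)) *
        (b (n * l) * χ⁻¹ (n : ZMod L)) * (W (t * ((n : ℝ) - m)) : ℂ)) := by
    rw [← sumAcross_sum, ← sumAcross_const_mul]
    refine sumAcross_congr fun m n _ _ _ _ => ?_
    have h2 := sum_charsOfConductorDvd_mul hr m n
    have h3 : ∑ χ ∈ charsOfConductorDvd L r, (a (m * l) * χ (m : ZMod L)) *
        (b (n * l) * χ⁻¹ (n : ZMod L)) * (W (t * ((n : ℝ) - m)) : ℂ) =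
        a (m * l) * b (n * l) * (∑ χ ∈ charsOfConductorDvd L r, χ (m : ZMod L) *
          χ⁻¹ (n : ZMod L)) * (W (t * ((n : ℝ) - m)) : ℂ) := by
      rw [Finset.mul_sum, Finset.sum_mul]
      exact Finset.sum_congr rfl fun χ _ => by ring
    rw [h3, h2]
    split_ifs <;> ring
  have h2 : ‖∑ χ ∈ charsOfConductorDvd L r,
      sumAcross (⌊X⌋₊ / l) (N / l) (fun m n => (a (m * l) * χ (m : ZMod L)) *
        (b (n * l) * χ⁻¹ (n : ZMod L)) * (W (t * ((n : ℝ) - m)) : ℂ))‖ ≤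
      r.totient * (18 * w * Z ^ 2 * (l : ℝ)⁻¹) := by
    rw [← card_charsOfConductorDvd hr, ← nsmul_eq_mul]
    refine (norm_sum_le _ _).trans (Finset.sum_le_card_nsmul _ _ _ fun χ _ => ?_)
    refine (norm_sum_sum_mul_weight_le hw0 hW0 hW1 hW2 hWsupp ht (Nat.div_le_div_right hN)
      (fun m => a (m * l) * χ (m : ZMod L)) (fun n => b (n * l) * χ⁻¹ (n : ZMod L))
      (A := Z * (X / l) ^ (1 / 2 : ℝ)) (B := 2 * (Z * (l : ℝ)⁻¹ * (X / l) ^ (-(1 / 2) : ℝ)))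
      (by positivity) (by positivity)
      (fun j hj => norm_sum_mul_char_le ha hX hε hl hlX hL hLQ χ hj hC)
      (fun j hj _ => norm_sum_Ioc_mul_char_le hb hX hε hl hlX hL hLQ χ⁻¹ hj hC)).trans
      (le_of_eq ?_)
    -- The bounds for a and b are balanced at X / l, so only the factor 1 / l of the tail bound
    -- remains.
    have h3 : (X / l) ^ (1 / 2 : ℝ) * (X / l) ^ (-(1 / 2) : ℝ) = 1 := by
      rw [← Real.rpow_add hXl]; norm_num
    linear_combination (18 * w * Z ^ 2 * (l : ℝ)⁻¹) * h3
  rw [← h1, norm_mul, Complex.norm_natCast] at h2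
  exact le_of_mul_le_mul_left h2 hφ

/-! ### Reciprocals of the totient. -/

/-- The product is smallest for the set {2, …, j + 1}, where it telescopes to 1 / (j + 1).
Inductively, the largest element exceeds the number of the others by at least 2. -/
lemma inv_card_add_one_le_prod (s : Finset ℕ) :
    (∀ p ∈ s, 2 ≤ p) → ((s.card : ℚ) + 1)⁻¹ ≤ ∏ p ∈ s, (1 - (p : ℚ)⁻¹) := by
  classical
  induction s using Finset.induction_on_max with
  | empty => simp
  | insert a s hmax ih =>
    intro h
    have ha : a ∉ s := fun h' => lt_irrefl _ (hmax a h')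
    have hsub : s ⊆ Finset.Ico 2 a := fun p hp =>
      Finset.mem_Ico.mpr ⟨h p (Finset.mem_insert_of_mem hp), hmax p hp⟩
    have hcard := Finset.card_le_card hsub
    rw [Nat.card_Ico] at hcard
    have ha2 : 2 ≤ a := h a (Finset.mem_insert_self _ _)
    have hca : (s.card : ℚ) + 2 ≤ a := by
      have : s.card + 2 ≤ a := by omega
      exact_mod_cast this
    rw [Finset.prod_insert ha, Finset.card_insert_of_notMem ha]
    have ih' := ih fun p hp => h p (Finset.mem_insert_of_mem hp)
    have hc0 : (0 : ℚ) ≤ s.card := Nat.cast_nonneg _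
    have h1 : 1 - ((s.card : ℚ) + 2)⁻¹ ≤ 1 - (a : ℚ)⁻¹ :=
      sub_le_sub_left (inv_anti₀ (by positivity) hca) 1
    have h2 : (((s.card + 1 : ℕ) : ℚ) + 1)⁻¹ =
        (1 - ((s.card : ℚ) + 2)⁻¹) * ((s.card : ℚ) + 1)⁻¹ := by
      push_cast
      field_simp
      ring
    have h3 : (0 : ℚ) ≤ 1 - ((s.card : ℚ) + 2)⁻¹ :=
      sub_nonneg.mpr (inv_le_one_of_one_le₀ (by linarith))
    rw [h2]
    exact mul_le_mul h1 ih' (by positivity) (h3.trans h1)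

lemma inv_totient_le {n : ℕ} (hn : 0 < n) :
    (n.totient : ℝ)⁻¹ ≤ (1 + Nat.log 2 n : ℕ) * (n : ℝ)⁻¹ := by
  have h1 := Nat.totient_eq_mul_prod_factors n
  have h2 := inv_card_add_one_le_prod n.primeFactors
    fun p hp => (Nat.prime_of_mem_primeFactors hp).two_le
  -- The product of the prime factors divides n, and each is at least 2.
  have h3 : n.primeFactors.card ≤ Nat.log 2 n := by
    apply Nat.le_log_of_pow_le one_lt_two
    calc 2 ^ n.primeFactors.card ≤ ∏ p ∈ n.primeFactors, p :=
          Finset.pow_card_le_prod _ _ _ fun p hp => (Nat.prime_of_mem_primeFactors hp).two_le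
      _ ≤ n := Nat.le_of_dvd hn (Nat.prod_primeFactors_dvd n)
  have hn' : (0 : ℚ) < n := by exact_mod_cast hn
  have h4 : (n : ℚ) * ((Nat.log 2 n : ℚ) + 1)⁻¹ ≤ n.totient := by
    rw [h1]
    refine mul_le_mul_of_nonneg_left (le_trans ?_ h2) hn'.le
    refine inv_anti₀ (by positivity) ?_
    have : (n.primeFactors.card : ℚ) ≤ Nat.log 2 n := by exact_mod_cast h3
    linarith
  have h5 : (n : ℝ) * ((Nat.log 2 n : ℝ) + 1)⁻¹ ≤ n.totient := by
    have := (Rat.cast_le (K := ℝ)).mpr h4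
    push_cast at this
    exact this
  have hn'' : (0 : ℝ) < n := by exact_mod_cast hn
  refine (inv_anti₀ (by positivity) h5).trans (le_of_eq ?_)
  push_cast
  rw [mul_inv, inv_inv]
  ring

lemma sum_inv_totient_le (R : ℕ) :
    ∑ d ∈ Finset.Ioc 0 R, (d.totient : ℝ)⁻¹ ≤ (1 + Nat.log 2 R : ℕ) * harmonicSum R := by
  rw [harmonicSum, Finset.mul_sum]
  refine Finset.sum_le_sum fun d hd => ?_
  rw [Finset.mem_Ioc] at hd
  refine (inv_totient_le hd.1).trans (mul_le_mul_of_nonneg_right ?_ (by positivity))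
  have : Nat.log 2 d ≤ Nat.log 2 R := Nat.log_mono_right hd.2
  exact_mod_cast Nat.add_le_add_left this 1

/-! ### The sieve sum as a sum of congruence sums. -/

lemma sum_Ioc_sum_divisorsAntidiagonal (R : ℕ) (G : ℕ → ℕ → ℂ) :
    ∑ q ∈ Finset.Ioc 0 R, ∑ x ∈ q.divisorsAntidiagonal, G x.1 x.2 =
      ∑ d ∈ Finset.Ioc 0 R, ∑ e ∈ Finset.Ioc 0 (R / d), G d e := by
  rw [Finset.sum_sigma', Finset.sum_sigma']
  refine Finset.sum_bij' (fun x _ => ⟨x.2.1, x.2.2⟩) (fun y _ => ⟨y.1 * y.2, (y.1, y.2)⟩)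
    ?_ ?_ ?_ ?_ ?_
  · rintro ⟨q, d, e⟩ h
    simp only [Finset.mem_sigma, Finset.mem_Ioc, Nat.mem_divisorsAntidiagonal] at h ⊢
    obtain ⟨⟨hq, hqR⟩, rfl, -⟩ := h
    have hd : 0 < d := Nat.pos_of_mul_pos_right hq
    have he : 0 < e := Nat.pos_of_mul_pos_left hq
    refine ⟨⟨hd, (Nat.le_mul_of_pos_right d he).trans hqR⟩, he, ?_⟩
    rwa [Nat.le_div_iff_mul_le hd, mul_comm]
  · rintro ⟨d, e⟩ h
    simp only [Finset.mem_sigma, Finset.mem_Ioc, Nat.mem_divisorsAntidiagonal] at h ⊢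
    obtain ⟨⟨hd, -⟩, he, heR⟩ := h
    rw [Nat.le_div_iff_mul_le hd, mul_comm] at heR
    exact ⟨⟨Nat.mul_pos hd he, heR⟩, trivial, (Nat.mul_pos hd he).ne'⟩
  · rintro ⟨q, d, e⟩ h
    simp only [Finset.mem_sigma, Nat.mem_divisorsAntidiagonal] at h
    obtain ⟨-, rfl, -⟩ := h
    rfl
  · rintro ⟨d, e⟩ _
    rfl
  · rintro ⟨q, d, e⟩ _
    rfl

open ArithmeticFunction in
/-- The sieve sum after Möbius inversion over imprimitive characters. -/
lemma sieveSum_eq {W : ℝ → ℝ} (hW : ∀ x, 2 < x → W x = 0) {Q : ℝ} (hQ : 1 ≤ Q) (X : ℝ)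
    (a b : ℕ → ℂ) :
    sieveSum W Q X a b = ∑ d ∈ Finset.Ioc 0 ⌊2 * Q⌋₊, ∑ e ∈ Finset.Ioc 0 (⌊2 * Q⌋₊ / d),
      ((W (((d * e : ℕ) : ℝ) / Q) : ℝ) : ℂ) / (Nat.totient (d * e) : ℂ) * (moebius d : ℂ) *
        ∑ χ ∈ charsOfConductorDvd (d * e) e, charA X a χ * charB X b χ⁻¹ := by
  rw [← sum_Ioc_sum_divisorsAntidiagonal ⌊2 * Q⌋₊ (fun d e =>
      ((W (((d * e : ℕ) : ℝ) / Q) : ℝ) : ℂ) / (Nat.totient (d * e) : ℂ) * (moebius d : ℂ) *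
        ∑ χ ∈ charsOfConductorDvd (d * e) e, charA X a χ * charB X b χ⁻¹)]
  unfold sieveSum
  rw [finsum_cond_eq_sum_of_cond_iff (t := Finset.Ioc 0 ⌊2 * Q⌋₊)]
  · refine Finset.sum_congr rfl fun q hq => ?_
    have : NeZero q := ⟨(Finset.mem_Ioc.mp hq).1.ne'⟩
    rw [sum_primitive_eq, Finset.mul_sum]
    refine Finset.sum_congr rfl fun x hx => ?_
    obtain ⟨d, e⟩ := x
    obtain ⟨rfl, -⟩ := Nat.mem_divisorsAntidiagonal.mp hx
    push_cast
    ring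
  · intro q hq
    rw [Finset.mem_Ioc]
    refine ⟨fun h => ⟨h, ?_⟩, fun h => h.1⟩
    by_contra hlt
    rw [not_le, Nat.floor_lt (by linarith)] at hlt
    apply hq
    rw [hW _ (by rwa [lt_div_iff₀ (by linarith)])]
    simp

/-- The bilinear form `∑ a_m b_n` over `m ≤ M < n ≤ N` with `m`, `n` coprime to `q` and congruent
modulo `e`. -/
noncomputable def congruenceSum (a b : ℕ → ℂ) (M N q e : ℕ) : ℂ :=
  sumAcross M N fun m n =>
    a m * b n * (if (m.Coprime q ∧ n.Coprime q) ∧ m ≡ n [MOD e] then 1 else 0)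

open ArithmeticFunction in
lemma sum_totient_div_mul_congruenceSum {d : ℕ} (hd : 0 < d) (a b : ℕ → ℂ) (w : ℝ → ℂ)
    (M N E : ℕ) :
    ∑ e ∈ Finset.Ioc 0 E, w e * ((Nat.totient e : ℂ) / Nat.totient (d * e)) *
        congruenceSum a b M N (d * e) e =
      (Nat.totient d : ℂ)⁻¹ * ∑ k ∈ d.divisors, (moebius k : ℂ) / k *
        sumAcross M N (fun m n => a m * b n * ∑ e ∈ Finset.Ioc 0 E,
          (if k ∣ e then (1 : ℂ) else 0) *
          (if (m.Coprime (d * e) ∧ n.Coprime (d * e)) ∧ m ≡ n [MOD e] then 1 else 0) * w e) := by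
  have h1 : ∀ k, sumAcross M N (fun m n => a m * b n * ∑ e ∈ Finset.Ioc 0 E,
          (if k ∣ e then (1 : ℂ) else 0) *
          (if (m.Coprime (d * e) ∧ n.Coprime (d * e)) ∧ m ≡ n [MOD e] then 1 else 0) * w e) =
      ∑ e ∈ Finset.Ioc 0 E, (w e * if k ∣ e then (1 : ℂ) else 0) *
        congruenceSum a b M N (d * e) e := by
    intro k
    simp only [congruenceSum, ← sumAcross_const_mul]
    rw [← sumAcross_sum]
    refine sumAcross_congr fun m n _ _ _ _ => ?_
    rw [Finset.mul_sum]
    exact Finset.sum_congr rfl fun e _ => by ring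
  simp only [h1]
  simp only [Finset.mul_sum]
  rw [Finset.sum_comm]
  refine Finset.sum_congr rfl fun e he => ?_
  rw [totient_div_totient_mul hd.ne' (Finset.mem_Ioc.mp he).1.ne', Finset.mul_sum, Finset.mul_sum,
    Finset.sum_mul]
  exact Finset.sum_congr rfl fun k _ => by ring

-- The main term for one d. The condition `hdN` makes F long enough to hold every complementary
-- divisor, while `hdF` keeps the new moduli d f' within the range 2Q of the hypotheses.
open ArithmeticFunction in
lemma norm_sum_congruenceSum_le {W : ℝ → ℝ} {w : ℝ} (hw0 : 0 ≤ w) (hW0 : ∀ x, |W x| ≤ w)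
    (hW1 : ∀ x y, |W y - W x| ≤ w * |y - x|)
    (hW2 : ∀ x h : ℝ, |W (x + h) - W x - (W x - W (x - h))| ≤ w * h ^ 2)
    (hWsupp : ∀ x, 2 < x → W x = 0) (hWsupp1 : ∀ x, x < 1 → W x = 0)
    {Q X ε : ℝ} {C : ℝ → ℝ} {a b : ℕ → ℂ}
    (ha : PartialSumBound Q X C a) (hb : TailSumBound Q X C b) (hQ : 1 ≤ Q)
    (hX : 1 ≤ X) (hε : 0 < ε) (hC : 0 ≤ C ε * Q ^ ε) {d N F : ℕ} (hd : 0 < d)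
    (hdF : (d : ℝ) * F ≤ 2 * Q) (hdN : (d : ℝ) * N < Q * (F + 1)) (hN : ⌊X⌋₊ ≤ N) :
    ‖∑ e ∈ Finset.Ioc 0 (⌊2 * Q⌋₊ / d), ((W (((d * e : ℕ) : ℝ) / Q) : ℝ) : ℂ) *
        ((Nat.totient e : ℂ) / Nat.totient (d * e)) * congruenceSum a b ⌊X⌋₊ N (d * e) e‖ ≤
      (d.totient : ℝ)⁻¹ * (harmonicSum d *
        (18 * w * (C ε * Q ^ ε) ^ 2 * harmonicSum ⌊X⌋₊ * (F * harmonicSum F))) := by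
  have hQ0 : 0 < Q := by linarith
  have hd0 : (0 : ℝ) < d := by exact_mod_cast hd
  have h := sum_totient_div_mul_congruenceSum hd a b (fun x => ((W (d * x / Q) : ℝ) : ℂ)) ⌊X⌋₊ N
    (⌊2 * Q⌋₊ / d)
  simp only [Nat.cast_mul]
  rw [h, norm_mul, norm_inv, Complex.norm_natCast]
  refine mul_le_mul_of_nonneg_left ?_ (by positivity)
  have hnn : 0 ≤ 18 * w * (C ε * Q ^ ε) ^ 2 := by positivity
  refine (norm_sum_le _ _).trans (le_trans ?_ (mul_le_mul_of_nonneg_right (sum_divisors_inv_le d)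
    (mul_nonneg (mul_nonneg hnn (harmonicSum_nonneg _))
      (mul_nonneg (Nat.cast_nonneg _) (harmonicSum_nonneg _)))))
  rw [Finset.sum_mul]
  refine Finset.sum_le_sum fun k hk => ?_
  have hkd := Nat.dvd_of_mem_divisors hk
  rw [norm_mul]
  refine mul_le_mul ?_ ?_ (norm_nonneg _) (by positivity)
  · rw [norm_div, Complex.norm_natCast, div_eq_mul_inv, Complex.norm_intCast]
    refine mul_le_of_le_one_left (by positivity) ?_
    exact_mod_cast abs_moebius_le_one
  · refine norm_sumAcross_modulus_le hkd a b (fun x => ((W (d * x / Q) : ℝ) : ℂ)) ?_ ?_ hnn ?_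
    · intro x hx
      rw [hWsupp, Complex.ofReal_zero]
      rw [lt_div_iff₀ hQ0]
      have h1 : ⌊2 * Q⌋₊ < d * (⌊2 * Q⌋₊ / d + 1) := Nat.lt_mul_div_succ _ hd
      rw [Nat.floor_lt (by positivity)] at h1
      push_cast at h1
      exact h1.trans_le (mul_le_mul_of_nonneg_left hx hd0.le)
    · intro x hx
      rw [hWsupp1, Complex.ofReal_zero]
      rw [div_lt_one hQ0]
      have hF : (0 : ℝ) < (F : ℝ) + 1 := by positivity
      refine lt_of_mul_lt_mul_right ?_ hF.le
      calc d * x * (F + 1) = d * (x * (F + 1)) := by ring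
        _ ≤ d * N := mul_le_mul_of_nonneg_left hx hd0.le
        _ < Q * (F + 1) := hdN
    · intro l f g hl hg hf hgf hfF
      obtain ⟨f', rfl⟩ := hgf
      have hf' : 0 < f' := Nat.pos_of_mul_pos_left hf
      have hdQ : 0 < (d : ℝ) * (((l * g : ℕ) : ℝ) / ((g * f' : ℕ) : ℝ)) / Q := by
        have : (0 : ℝ) < ((l * g : ℕ) : ℝ) := by exact_mod_cast Nat.mul_pos hl hg
        have : (0 : ℝ) < ((g * f' : ℕ) : ℝ) := by exact_mod_cast hf
        positivity
      rw [Nat.mul_div_cancel_left _ hg]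
      have hL : ((d * f' : ℕ) : ℝ) ≤ 2 * Q := by
        refine le_trans ?_ hdF
        push_cast
        refine mul_le_mul_of_nonneg_left ?_ hd0.le
        exact_mod_cast (Nat.le_mul_of_pos_left f' hg).trans hfF
      -- The modulus d f' carries the coprimality conditions; the congruence is only modulo its
      -- divisor k f'.
      have := norm_sumAcross_modEq_le hw0 hW0 hW1 hW2 hWsupp ha hb hX hε hC (l := l * g)
        (L := d * f') (r := k * f') (Nat.mul_pos hl hg) (Nat.mul_pos hd hf') hL
        (Nat.mul_dvd_mul_right hkd f') hN hdQ
      refine le_of_eq_of_le ?_ this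
      congr 2
      funext m n
      congr 4
      ring

/-! ### Truncation of B and choice of the cut-off. -/

lemma norm_sum_charA_mul_charB_sub_le {Q X ε : ℝ} {C : ℝ → ℝ} {a b : ℕ → ℂ}
    (ha : PartialSumBound Q X C a) (hb : TailSumBound Q X C b)
    (hX : 1 ≤ X) (hε : 0 < ε) (hC : 0 ≤ C ε * Q ^ ε) {q e : ℕ} (hq : 0 < q) (he : e ∣ q)
    (hqQ : (q : ℝ) ≤ 2 * Q) {v : ℝ} (hv : X ≤ v) :
    ‖∑ χ ∈ charsOfConductorDvd q e, charA X a χ * charB X b χ⁻¹ -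
        e.totient * congruenceSum a b ⌊X⌋₊ ⌊v⌋₊ q e‖ ≤
      e.totient * ((C ε * Q ^ ε) ^ 2 * (X ^ (1 / 2 : ℝ) * v ^ (-(1 / 2) : ℝ))) := by
  have : NeZero q := ⟨hq.ne'⟩
  have h1 : (e.totient : ℂ) * congruenceSum a b ⌊X⌋₊ ⌊v⌋₊ q e =
      ∑ χ ∈ charsOfConductorDvd q e, charA X a χ *
        ∑ n ∈ Finset.Ioc ⌊X⌋₊ ⌊v⌋₊, b n * χ⁻¹ (n : ZMod q) := by
    have h2 : ∀ χ : DirichletCharacter ℂ q, charA X a χ *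
        ∑ n ∈ Finset.Ioc ⌊X⌋₊ ⌊v⌋₊, b n * χ⁻¹ (n : ZMod q) =
        sumAcross ⌊X⌋₊ ⌊v⌋₊ (fun m n => a m * b n * (χ (m : ZMod q) * χ⁻¹ (n : ZMod q))) := by
      intro χ
      rw [charA_eq_sum_Ioc, Finset.sum_mul_sum]
      exact Finset.sum_congr rfl fun m _ => Finset.sum_congr rfl fun n _ => by ring
    simp only [h2]
    rw [← sumAcross_sum, congruenceSum, ← sumAcross_const_mul]
    refine sumAcross_congr fun m n _ _ _ _ => ?_
    rw [← Finset.mul_sum, sum_charsOfConductorDvd_mul he]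
    split_ifs <;> ring
  rw [h1, ← Finset.sum_sub_distrib, ← card_charsOfConductorDvd he, ← nsmul_eq_mul]
  refine (norm_sum_le _ _).trans (Finset.sum_le_card_nsmul _ _ _ fun χ _ => ?_)
  rw [← mul_sub, norm_mul]
  refine (mul_le_mul (norm_charA_le ha hX hε hq hqQ χ hC)
    (norm_charB_sub_sum_le hb hX hε hq hqQ χ⁻¹ hv) (norm_nonneg _) (by positivity)).trans
    (le_of_eq ?_)
  ring

/-- The left side is (X/v)^{1/2} = min(1, y) for the cut-off v used below. -/
lemma rpow_half_mul_rpow_neg_half_le {X y : ℝ} (hX : 0 < X) (hy : 0 < y) :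
    X ^ (1 / 2 : ℝ) * (X * max 1 y⁻¹ ^ 2) ^ (-(1 / 2) : ℝ) ≤ y := by
  have hm : 0 < max 1 y⁻¹ := lt_max_of_lt_left one_pos
  have h1 : (max 1 y⁻¹ ^ 2) ^ (-(1 / 2) : ℝ) = (max 1 y⁻¹)⁻¹ := by
    rw [← Real.rpow_natCast, ← Real.rpow_mul hm.le,
      show ((2 : ℕ) : ℝ) * (-(1 / 2)) = -1 by norm_num, Real.rpow_neg_one]
  rw [Real.mul_rpow hX.le (by positivity), h1, ← mul_assoc, ← Real.rpow_add hX]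
  norm_num
  exact inv_le_of_inv_le₀ hy (le_max_right _ _)

-- The constant 20 is 2 from truncation plus 18 from the dual sum. Of the five logarithms, three
-- come from the sums over k, l and g, and two from the sum of 1/φ(d).
open ArithmeticFunction in
lemma norm_sieveSum_le {W : ℝ → ℝ} {w : ℝ} (hw0 : 0 ≤ w) (hW0 : ∀ x, |W x| ≤ w)
    (hW1 : ∀ x y, |W y - W x| ≤ w * |y - x|)
    (hW2 : ∀ x h : ℝ, |W (x + h) - W x - (W x - W (x - h))| ≤ w * h ^ 2)
    (hWsupp : ∀ x, 2 < x → W x = 0) (hWsupp1 : ∀ x, x < 1 → W x = 0)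
    {Q X ε : ℝ} {C : ℝ → ℝ} {a b : ℕ → ℂ}
    (ha : PartialSumBound Q X C a) (hb : TailSumBound Q X C b) (hQ : 1 ≤ Q)
    (hX : 1 ≤ X) (hε : 0 < ε) (hC : 0 ≤ C ε * Q ^ ε) {T : ℝ} (hT : 0 < T) (hT3 : T ^ 3 = Q * X) :
    ‖sieveSum W Q X a b‖ ≤
      20 * w * (C ε * Q ^ ε) ^ 2 * (2 * (1 + Real.log Q)) ^ 5 * T := by
  have hQ0 : 0 < Q := by linarith
  have hX0 : 0 < X := by linarith
  have hlogQ : 0 ≤ Real.log Q := Real.log_nonneg hQ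
  set Z := C ε * Q ^ ε with hZ
  set L := 2 * (1 + Real.log Q) with hL
  set R := ⌊2 * Q⌋₊ with hR
  have hL1 : 1 ≤ L := by rw [hL]; linarith
  have hL0 : 0 ≤ L := by linarith
  have hRQ : (R : ℝ) ≤ 2 * Q := Nat.floor_le (by positivity)
  have hR1 : 0 < R := Nat.floor_pos.mpr (by linarith)
  have hlogR : Real.log R ≤ Real.log 2 + Real.log Q := by
    rw [← Real.log_mul two_ne_zero hQ0.ne']
    exact Real.log_le_log (by exact_mod_cast hR1) hRQ
  have hlog2 := Real.log_two_gt_d9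
  have hlog2' := Real.log_two_lt_d9
  have hHR : harmonicSum R ≤ L := by
    refine (harmonicSum_le R).trans ?_
    rw [hL]
    linarith
  have hlogL : ((1 + Nat.log 2 R : ℕ) : ℝ) ≤ L := by
    have h1 : (Nat.log 2 R : ℝ) ≤ Real.logb 2 R := by
      exact_mod_cast Real.natLog_le_logb R 2
    have h2 : Real.logb 2 R ≤ 1 + 2 * Real.log Q := by
      rw [Real.logb, div_le_iff₀ (by linarith)]
      nlinarith
    push_cast
    rw [hL]
    linarith
  have hφ : ∑ d ∈ Finset.Ioc 0 R, (d.totient : ℝ)⁻¹ ≤ L ^ 2 := by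
    refine (sum_inv_totient_le R).trans ?_
    rw [sq]
    exact mul_le_mul hlogL hHR (harmonicSum_nonneg _) hL0
  have hd : ∀ d ∈ Finset.Ioc 0 R, ‖∑ e ∈ Finset.Ioc 0 (R / d),
      ((W (((d * e : ℕ) : ℝ) / Q) : ℝ) : ℂ) / (Nat.totient (d * e) : ℂ) * (moebius d : ℂ) *
        ∑ χ ∈ charsOfConductorDvd (d * e) e, charA X a χ * charB X b χ⁻¹‖ ≤
      (d.totient : ℝ)⁻¹ * (20 * w * Z ^ 2 * L ^ 3 * T) := by
    intro d hd
    rw [Finset.mem_Ioc] at hd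
    have hd0 : (0 : ℝ) < d := by exact_mod_cast hd.1
    -- There are at most 2Q/d values of e, so a relative truncation error of y = dT/Q makes the
    -- total O(T). The cut-off v achieves this without falling below X.
    set y := (d : ℝ) * T / Q with hy
    have hy0 : 0 < y := by positivity
    set v := X * max 1 y⁻¹ ^ 2 with hv
    have hXv : X ≤ v := by
      have : (1 : ℝ) ≤ max 1 y⁻¹ := le_max_left _ _
      exact le_mul_of_one_le_right hX0.le (one_le_pow₀ this)
    have hsplit : ∑ e ∈ Finset.Ioc 0 (R / d),
      ((W (((d * e : ℕ) : ℝ) / Q) : ℝ) : ℂ) / (Nat.totient (d * e) : ℂ) * (moebius d : ℂ) *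
        ∑ χ ∈ charsOfConductorDvd (d * e) e, charA X a χ * charB X b χ⁻¹ =
      (moebius d : ℂ) * (∑ e ∈ Finset.Ioc 0 (R / d),
          ((W (((d * e : ℕ) : ℝ) / Q) : ℝ) : ℂ) / (Nat.totient (d * e) : ℂ) *
          (∑ χ ∈ charsOfConductorDvd (d * e) e, charA X a χ * charB X b χ⁻¹ -
            e.totient * congruenceSum a b ⌊X⌋₊ ⌊v⌋₊ (d * e) e) +
        ∑ e ∈ Finset.Ioc 0 (R / d), ((W (((d * e : ℕ) : ℝ) / Q) : ℝ) : ℂ) *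
          ((Nat.totient e : ℂ) / Nat.totient (d * e)) *
            congruenceSum a b ⌊X⌋₊ ⌊v⌋₊ (d * e) e) := by
      rw [← Finset.sum_add_distrib, Finset.mul_sum]
      exact Finset.sum_congr rfl fun e _ => by ring
    rw [hsplit, norm_mul, Complex.norm_intCast]
    refine (mul_le_of_le_one_left (norm_nonneg _) (by exact_mod_cast abs_moebius_le_one)).trans ?_
    have hφd : (0 : ℝ) < d.totient := by exact_mod_cast Nat.totient_pos.mpr hd.1
    have hL3 : 1 ≤ L ^ 3 := one_le_pow₀ hL1
    have hB1 : ‖∑ e ∈ Finset.Ioc 0 (R / d),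
          ((W (((d * e : ℕ) : ℝ) / Q) : ℝ) : ℂ) / (Nat.totient (d * e) : ℂ) *
          (∑ χ ∈ charsOfConductorDvd (d * e) e, charA X a χ * charB X b χ⁻¹ -
            e.totient * congruenceSum a b ⌊X⌋₊ ⌊v⌋₊ (d * e) e)‖ ≤
        (d.totient : ℝ)⁻¹ * (2 * w * Z ^ 2 * T) := by
      have hterm : ∀ e ∈ Finset.Ioc 0 (R / d),
          ‖((W (((d * e : ℕ) : ℝ) / Q) : ℝ) : ℂ) / (Nat.totient (d * e) : ℂ) *
          (∑ χ ∈ charsOfConductorDvd (d * e) e, charA X a χ * charB X b χ⁻¹ -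
            e.totient * congruenceSum a b ⌊X⌋₊ ⌊v⌋₊ (d * e) e)‖ ≤
          w * (d.totient : ℝ)⁻¹ * (Z ^ 2 * y) := by
        intro e he
        rw [Finset.mem_Ioc] at he
        have hde : 0 < d * e := Nat.mul_pos hd.1 he.1
        have hφde : (0 : ℝ) < (d * e).totient := by exact_mod_cast Nat.totient_pos.mpr hde
        have hdeQ : ((d * e : ℕ) : ℝ) ≤ 2 * Q := by
          refine le_trans ?_ hRQ
          exact_mod_cast (Nat.mul_le_mul_left d he.2).trans (Nat.mul_div_le R d)
        have h1 := norm_sum_charA_mul_charB_sub_le ha hb hX hε hC hde (Dvd.intro_left d rfl) hdeQ hXv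
        have h2 : X ^ (1 / 2 : ℝ) * v ^ (-(1 / 2) : ℝ) ≤ y :=
          rpow_half_mul_rpow_neg_half_le hX0 hy0
        have h3 : (d.totient : ℝ) * e.totient ≤ (d * e).totient := by
          exact_mod_cast Nat.totient_super_multiplicative d e
        rw [norm_mul, norm_div, Complex.norm_natCast, Complex.norm_real]
        calc ‖W (((d * e : ℕ) : ℝ) / Q)‖ / (d * e).totient *
              ‖∑ χ ∈ charsOfConductorDvd (d * e) e, charA X a χ * charB X b χ⁻¹ -
                e.totient * congruenceSum a b ⌊X⌋₊ ⌊v⌋₊ (d * e) e‖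
            ≤ w / (d * e).totient * (e.totient * (Z ^ 2 * y)) := by
              refine mul_le_mul (div_le_div_of_nonneg_right (hW0 _) hφde.le) (h1.trans ?_)
                (norm_nonneg _) (by positivity)
              exact mul_le_mul_of_nonneg_left (mul_le_mul_of_nonneg_left h2 (sq_nonneg _))
                (Nat.cast_nonneg _)
          _ = w * (e.totient / (d * e).totient) * (Z ^ 2 * y) := by ring
          _ ≤ w * (d.totient : ℝ)⁻¹ * (Z ^ 2 * y) := by
              refine mul_le_mul_of_nonneg_right (mul_le_mul_of_nonneg_left ?_ hw0) (by positivity)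
              rw [div_le_iff₀ hφde, inv_mul_eq_div, le_div_iff₀ hφd, mul_comm]
              exact h3
      refine (norm_sum_le _ _).trans ((Finset.sum_le_card_nsmul _ _ _ hterm).trans ?_)
      rw [Nat.card_Ioc, Nat.sub_zero, nsmul_eq_mul]
      have h4 : ((R / d : ℕ) : ℝ) ≤ 2 * Q / d :=
        Nat.cast_div_le.trans (div_le_div_of_nonneg_right hRQ hd0.le)
      refine (mul_le_mul_of_nonneg_right h4 (by positivity)).trans (le_of_eq ?_)
      rw [hy]
      field_simp
    have hB2 : ‖∑ e ∈ Finset.Ioc 0 (R / d), ((W (((d * e : ℕ) : ℝ) / Q) : ℝ) : ℂ) *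
          ((Nat.totient e : ℂ) / Nat.totient (d * e)) *
            congruenceSum a b ⌊X⌋₊ ⌊v⌋₊ (d * e) e‖ ≤
        (d.totient : ℝ)⁻¹ * (18 * w * Z ^ 2 * L ^ 3 * T) := by
      -- If y ≥ 1 then v = X: the truncated form is empty and the truncation error carries
      -- everything.
      rcases le_or_gt 1 y with hy1 | hy1
      · have hvX : v = X := by
          rw [hv, max_eq_left (inv_le_one_of_one_le₀ hy1)]; ring
        rw [hvX]
        simp only [congruenceSum, sumAcross, Finset.Ioc_self, Finset.sum_empty,
          Finset.sum_const_zero, mul_zero, norm_zero]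
        positivity
      · have hvX : v = X * (y⁻¹) ^ 2 := by
          rw [hv, max_eq_right ((one_le_inv₀ hy0).mpr hy1.le)]
        have hdT : (d : ℝ) * T < Q := by rwa [hy, div_lt_one hQ0] at hy1
        have hdvT : d * v / Q * d = T := by
          rw [hvX, hy]
          field_simp
          linear_combination -hT3
        have hd1 : (1 : ℝ) ≤ d := by exact_mod_cast hd.1
        have hTQ : T ≤ Q := by nlinarith
        set F := ⌊d * v / Q⌋₊ with hF
        have hv0 : 0 < v := by linarith
        have hFle : (F : ℝ) ≤ d * v / Q := Nat.floor_le (by positivity)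
        have hdF : (d : ℝ) * F ≤ T := by
          rw [← hdvT, mul_comm]
          exact mul_le_mul_of_nonneg_right hFle hd0.le
        have hFT : (F : ℝ) ≤ T := by
          have : (0 : ℝ) ≤ F := Nat.cast_nonneg _
          nlinarith
        have hFR : F ≤ R := Nat.le_floor (by linarith)
        -- From T ≤ Q, available only in this case; it bounds log X by 2 log Q.
        have hXQ : X ≤ Q ^ 2 := by
          have : T ^ 3 ≤ Q ^ 3 := pow_le_pow_left₀ hT.le hTQ 3
          rw [hT3] at this
          exact le_of_mul_le_mul_left (by linarith [this, (by ring : Q ^ 3 = Q * Q ^ 2)]) hQ0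
        have hHM : harmonicSum ⌊X⌋₊ ≤ L := by
          refine (harmonicSum_le _).trans ?_
          have h5 : Real.log ⌊X⌋₊ ≤ 2 * Real.log Q := by
            have h6 : Real.log (Q ^ 2) = 2 * Real.log Q := by
              rw [Real.log_pow]; norm_num
            rw [← h6]
            refine Real.log_le_log ?_ ((Nat.floor_le hX0.le).trans hXQ)
            exact_mod_cast Nat.floor_pos.mpr hX
          rw [hL]
          linarith
        have hdN : (d : ℝ) * ⌊v⌋₊ < Q * (F + 1) := by
          have h5 : d * v / Q < F + 1 := Nat.lt_floor_add_one _
          rw [div_lt_iff₀ hQ0] at h5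
          calc (d : ℝ) * ⌊v⌋₊ ≤ d * v :=
                mul_le_mul_of_nonneg_left (Nat.floor_le hv0.le) hd0.le
            _ < (F + 1) * Q := h5
            _ = Q * (F + 1) := mul_comm _ _
        refine (norm_sum_congruenceSum_le hw0 hW0 hW1 hW2 hWsupp hWsupp1 ha hb hQ hX hε hC hd.1
          (by linarith) hdN (Nat.floor_mono hXv)).trans ?_
        refine mul_le_mul_of_nonneg_left ?_ (by positivity)
        have h6 : harmonicSum d ≤ L := (harmonicSum_mono hd.2).trans hHR
        have h7 : harmonicSum F ≤ L := (harmonicSum_mono hFR).trans hHR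
        have h8 := harmonicSum_nonneg d
        have h9 := harmonicSum_nonneg F
        have h10 := harmonicSum_nonneg ⌊X⌋₊
        calc harmonicSum d * (18 * w * Z ^ 2 * harmonicSum ⌊X⌋₊ * (F * harmonicSum F))
            ≤ L * (18 * w * Z ^ 2 * L * (T * L)) := by gcongr
          _ = 18 * w * Z ^ 2 * L ^ 3 * T := by ring
    refine (norm_add_le _ _).trans ((add_le_add hB1 hB2).trans ?_)
    rw [← mul_add]
    refine mul_le_mul_of_nonneg_left ?_ (by positivity)
    have : 2 * w * Z ^ 2 * T * 1 ≤ 2 * w * Z ^ 2 * T * L ^ 3 :=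
      mul_le_mul_of_nonneg_left hL3 (by positivity)
    linarith
  rw [sieveSum_eq hWsupp hQ]
  refine (norm_sum_le _ _).trans ((Finset.sum_le_sum hd).trans ?_)
  rw [← Finset.sum_mul]
  refine (mul_le_mul_of_nonneg_right hφ (by positivity)).trans (le_of_eq ?_)
  ring

/-! ### Final choice of exponents. -/

theorem theorem3 (W : ℝ → ℝ) (hW : ContDiff ℝ ∞ W) (hWsupp : Function.support W ⊆ Set.Icc 1 2)
    (ε : ℝ) (hε : 0 < ε) (K : ℝ) (C : ℝ → ℝ) :
    ∃ D : ℝ, ∀ (Q X : ℝ) (a b : ℕ → ℂ), 1 ≤ Q → 1 ≤ X → X ≤ K * Q ^ (2 - 4 * ε) →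
      PartialSumBound Q X C a → TailSumBound Q X C b →
        ‖sieveSum W Q X a b‖ ≤ D * Q ^ (1 - ε) := by
  obtain ⟨w, hw0, hW0, hW1, hW2⟩ := exists_difference_bounds hW hWsupp
  have hsupp2 : ∀ x, 2 < x → W x = 0 := fun x hx => by
    by_contra h
    exact absurd (hWsupp h).2 (not_le.mpr hx)
  have hsupp1 : ∀ x, x < 1 → W x = 0 := fun x hx => by
    by_contra h
    exact absurd (hWsupp h).1 (not_le.mpr hx)
  -- T saves ε/3 beyond Q^{1-ε}. Half pays for the square of Q^{ε/12}, half for five logarithms at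
  -- Q^{ε/30} each.
  refine ⟨20 * w * C (ε / 12) ^ 2 * (2 * (1 + 30 / ε)) ^ 5 * K ^ (1 / 3 : ℝ),
    fun Q X a b hQ hX hXK ha hb => ?_⟩
  have hQ0 : 0 < Q := by linarith
  have hX0 : 0 < X := by linarith
  have hK : 0 < K := by
    by_contra h
    have : K * Q ^ (2 - 4 * ε) ≤ 0 :=
      mul_nonpos_of_nonpos_of_nonneg (not_lt.mp h) (Real.rpow_nonneg hQ0.le _)
    linarith
  -- The sign of C is not assumed; it follows from the bound for a at u = 1 with the character
  -- modulo 1.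
  have hC : 0 ≤ C (ε / 12) * Q ^ (ε / 12) := by
    have h := ha (ε / 12) (by positivity) 1 1 1 le_rfl (by simpa using hX) le_rfl (by simpa using hX)
      le_rfl (by push_cast; linarith) 1 1 one_pos (by simpa using hX)
    rw [Real.one_rpow, mul_one] at h
    exact (norm_nonneg _).trans h
  have hT3 : ((Q * X) ^ (1 / 3 : ℝ)) ^ 3 = Q * X := by
    rw [← Real.rpow_natCast, ← Real.rpow_mul (by positivity)]
    norm_num
  refine (norm_sieveSum_le hw0 hW0 hW1 hW2 hsupp2 hsupp1 ha hb hQ hX (by positivity) hC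
    (by positivity) hT3).trans ?_
  have hlog : 1 + Real.log Q ≤ (1 + 30 / ε) * Q ^ (ε / 30) := by
    have h1 := Real.log_le_rpow_div hQ0.le (by positivity : 0 < ε / 30)
    have h2 : 1 ≤ Q ^ (ε / 30) := Real.one_le_rpow hQ (by positivity)
    have h3 : Q ^ (ε / 30) / (ε / 30) = 30 / ε * Q ^ (ε / 30) := by field_simp
    linarith
  have hL5 : (2 * (1 + Real.log Q)) ^ 5 ≤ (2 * (1 + 30 / ε)) ^ 5 * Q ^ (ε / 6) := by
    have h1 : Q ^ (ε / 6) = (Q ^ (ε / 30)) ^ 5 := by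
      rw [← Real.rpow_natCast, ← Real.rpow_mul hQ0.le]
      congr 1
      push_cast
      ring
    rw [h1, ← mul_pow]
    have := Real.log_nonneg hQ
    exact pow_le_pow_left₀ (by positivity) (by linarith) 5
  have hZ : (C (ε / 12) * Q ^ (ε / 12)) ^ 2 = C (ε / 12) ^ 2 * Q ^ (ε / 6) := by
    have h1 : Q ^ (ε / 6) = (Q ^ (ε / 12)) ^ 2 := by
      rw [← Real.rpow_natCast, ← Real.rpow_mul hQ0.le]
      congr 1
      push_cast
      ring
    rw [h1, mul_pow]
  have hT : (Q * X) ^ (1 / 3 : ℝ) ≤ K ^ (1 / 3 : ℝ) * Q ^ (1 - 4 / 3 * ε) := by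
    have h1 : Q * X ≤ K * Q ^ (3 - 4 * ε) := by
      have h2 : Q ^ (3 - 4 * ε) = Q * Q ^ (2 - 4 * ε) := by
        rw [show 3 - 4 * ε = 1 + (2 - 4 * ε) by ring, Real.rpow_add hQ0, Real.rpow_one]
      rw [h2]
      nlinarith
    refine (Real.rpow_le_rpow (by positivity) h1 (by norm_num)).trans (le_of_eq ?_)
    rw [Real.mul_rpow hK.le (by positivity), ← Real.rpow_mul hQ0.le]
    congr 2
    ring
  rw [hZ]
  have hQQ : Q ^ (1 - ε) = Q ^ (ε / 6) * Q ^ (ε / 6) * Q ^ (1 - 4 / 3 * ε) := by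
    rw [← Real.rpow_add hQ0, ← Real.rpow_add hQ0]
    congr 1
    ring
  rw [hQQ]
  calc 20 * w * (C (ε / 12) ^ 2 * Q ^ (ε / 6)) * (2 * (1 + Real.log Q)) ^ 5 *
        (Q * X) ^ (1 / 3 : ℝ)
      ≤ 20 * w * (C (ε / 12) ^ 2 * Q ^ (ε / 6)) * ((2 * (1 + 30 / ε)) ^ 5 * Q ^ (ε / 6)) *
        (K ^ (1 / 3 : ℝ) * Q ^ (1 - 4 / 3 * ε)) := by
        have := Real.log_nonneg hQ
        gcongr
    _ = _ := by ring
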